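/- Let $p$ be a prime, $G\cong C_p\times C_p$, and $N$ a subgroup of $G$ of order $p$. For a subgroup $H\leqslant G$ write $\widehat H=\sum_{h\in H}h$, and define idempotents of $\mathbb{Q}_pG$ by $e_0=\frac1{p^2}\widehat G$ and $e_H=\frac1{p^2}(p\widehat H-\widehat G)$ for each subgroup $H$ of order $p$. Let $I$ consist of the symbol $0$ and the subgroups of $G$ of order $p$. A $\mathbb{Z}_p$-module is a lattice if it is free of finite rank; a $\mathbb{Z}_pG$-lattice is a $\mathbb{Z}_pG$-module that is a lattice over $\mathbb{Z}_p$. A $\mathbb{Z}_pG$-lattice $U$ is reduced if it has no non-zero free direct summand and no direct summand isomorphic to $e_i\mathbb{Z}_pG$ for any $i\in I$. Let $U$ be a reduced $\mathbb{Z}_pG$-lattice. Regard $U$ as the sublattice $1\otimes U$ of $\mathbb{Q}_p\otimes_{\mathbb{Z}_p}U$, and put $U_{(i)}=e_iU$ for $i\in I$, $U_*=\sum_{i\in I}U_{(i)}$, $V=U_*/U$ and $V_{(i)}=(U_{(i)}+U)/U\subseteq V$. Let $I_N$ be the augmentation ideal of $\mathbb{Z}_pN$, that is, the kernel of $\mathbb{Z}_pN\to\mathbb{Z}_p$,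 $\sum\lambda_n n\mapsto\sum\lambda_n$; let $U_N=U/I_NU$, and let $V^N$ be the set of elements of $V$ fixed by every element of $N$. Theorem. The module $U_N$ is a lattice if and only if the restriction of $U$ to $N$ is a permutation module (that is, $U$ has a $\mathbb{Z}_p$-basis preserved setwise by multiplication by the elements of $N$). Moreover, $U_N$ is a lattice if and only if both of the following conditions hold: 1. for each subgroup $H\neq N$ of $G$ of order $p$, $V_{(H)}\cap\sum_{K\neq N,H}V_{(K)}\subseteq I_NV_{(H)}$, where $K$ runs over the subgroups of $G$ of order $p$ different from $N$ and $H$; 2. $V^N\subseteq V_{(0)}+V_{(N)}$. -/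

import Mathlib

namespace ButlerLattice

open scoped TensorProduct MonoidAlgebra AlgebraMonoidAlgebra

noncomputable section

/-- A `ℤ_p`-module is a lattice if it is free of finite rank. -/
structure IsLattice (p : ℕ) [Fact p.Prime] (M : Type*) [AddCommGroup M] [Module ℤ_[p] M] :
    Prop where
  finite : Module.Finite ℤ_[p] M
  free : Module.Free ℤ_[p] M

/-- The augmentation map `ℤ_p N → ℤ_p`, sending `∑ λ_n n` to `∑ λ_n`. -/
def augmentation (p : ℕ) [Fact p.Prime] (N : Type*) [Group N] : ℤ_[p][N] →ₐ[ℤ_[p]] ℤ_[p] :=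
  MonoidAlgebra.lift ℤ_[p] ℤ_[p] N 1

/-- The augmentation ideal `I_N` of a subgroup `N`, as the ideal of `ℤ_p G` generated by the
kernel of `ℤ_p N → ℤ_p`.  For a `ℤ_p G`-submodule `W`, the product `I_N • W` is the usual
`I_N W`. -/
def augIdeal (p : ℕ) [Fact p.Prime] {G : Type*} [CommGroup G] (N : Subgroup G) :
    Ideal ℤ_[p][G] :=
  Ideal.map (MonoidAlgebra.mapDomainRingHom ℤ_[p] N.subtype)
    (RingHom.ker (augmentation p N))

/-- The indexing set `I`: `none` is the index `0`, and `some H` is the index of the subgroup `H`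
of order `p`. -/
abbrev Idx (p : ℕ) (G : Type*) [Group G] : Type _ :=
  Option {H : Subgroup G // Nat.card H = p}

/-- The element `Ĥ = ∑_{h ∈ H} h` of `ℚ_p G` (for a finite group `G`). -/
def hat (p : ℕ) [Fact p.Prime] {G : Type*} [CommGroup G] (H : Subgroup G) : ℚ_[p][G] :=
  ∑ᶠ h : H, MonoidAlgebra.of ℚ_[p] G (h : G)

/-- The primitive idempotents `e_0 = p⁻² Ĝ` and `e_H = p⁻² (p Ĥ - Ĝ)` of `ℚ_p G`, for
`G = C_p × C_p`. -/
def idem (p : ℕ) [Fact p.Prime] {G : Type*} [CommGroup G] : Idx p G → ℚ_[p][G]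
  | none => ((p : ℚ_[p]) ^ 2)⁻¹ • hat p (⊤ : Subgroup G)
  | some H => ((p : ℚ_[p]) ^ 2)⁻¹ • ((p : ℚ_[p]) • hat p H.1 - hat p (⊤ : Subgroup G))

/-- `Λ_(i) = e_i ℤ_p G`, as a `ℤ_p G`-submodule of `ℚ_p G`. -/
def Lam (p : ℕ) [Fact p.Prime] {G : Type*} [CommGroup G] (i : Idx p G) :
    Submodule ℤ_[p][G] ℚ_[p][G] :=
  Submodule.span ℤ_[p][G] {idem p i}

section Lattice

variable (p : ℕ) [Fact p.Prime] (G : Type*) [CommGroup G]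
  (U : Type*) [AddCommGroup U] [Module ℤ_[p] U] [Module ℤ_[p][G] U]
  [IsScalarTower ℤ_[p] ℤ_[p][G] U]

/-- `U` is reduced: it has no (non-zero) free direct summand, and no direct summand isomorphic
to any `Λ_(i)`. -/
structure IsReduced : Prop where
  no_free : ∀ W W' : Submodule ℤ_[p][G] U, IsCompl W W' → Module.Free ℤ_[p][G] W → W = ⊥
  no_Lam : ∀ (i : Idx p G) (W W' : Submodule ℤ_[p][G] U), IsCompl W W' →
    IsEmpty (W ≃ₗ[ℤ_[p][G]] Lam p i)

/-- `ℚ_p U = ℚ_p ⊗_{ℤ_p} U`. -/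
def RatSpan (p : ℕ) [Fact p.Prime] (U : Type*) [AddCommGroup U] [Module ℤ_[p] U] : Type _ :=
  ℚ_[p] ⊗[ℤ_[p]] U

instance : AddCommGroup (RatSpan p U) :=
  inferInstanceAs (AddCommGroup (ℚ_[p] ⊗[ℤ_[p]] U))

instance : Module ℚ_[p] (RatSpan p U) :=
  inferInstanceAs (Module ℚ_[p] (ℚ_[p] ⊗[ℤ_[p]] U))

/-- The action of `G` on `ℚ_p ⊗ U`, with `g (a ⊗ u) = a ⊗ g u`. -/
def ratRep : Representation ℚ_[p] G (RatSpan p U) where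
  toFun g := LinearMap.baseChange ℚ_[p]
    (Algebra.lsmul ℤ_[p] ℤ_[p] U (MonoidAlgebra.of ℤ_[p] G g))
  map_one' := by
    rw [map_one, map_one]
    exact LinearMap.baseChange_id
  map_mul' g h := by
    rw [map_mul, map_mul]
    exact LinearMap.baseChange_mul _ _

/-- `ℚ_p U` as a `ℚ_p G`-module. -/
instance : Module ℚ_[p][G] (RatSpan p U) :=
  Module.compHom _ (ratRep p G U).asAlgebraHom.toRingHom

/-- `ℚ_p U` as a `ℤ_p G`-module, by restriction of scalars. -/
instance : Module ℤ_[p][G] (RatSpan p U) :=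
  Module.compHom _ (algebraMap ℤ_[p][G] ℚ_[p][G])

instance : IsScalarTower ℤ_[p][G] ℚ_[p][G] (RatSpan p U) :=
  IsScalarTower.of_algebraMap_smul fun _ _ => rfl

instance : SMulCommClass ℚ_[p][G] ℤ_[p][G] (RatSpan p U) :=
  IsScalarTower.to_smulCommClass'

/-- The map `U → ℚ_p U`, `u ↦ 1 ⊗ u`, of `ℤ_p G`-modules. -/
def toRatSpan : U →ₗ[ℤ_[p][G]] RatSpan p U where
  toFun u := (1 : ℚ_[p]) ⊗ₜ[ℤ_[p]] u
  map_add' u v := TensorProduct.tmul_add _ _ _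
  map_smul' r u := by
    change (1 : ℚ_[p]) ⊗ₜ[ℤ_[p]] (r • u) =
      (algebraMap ℤ_[p][G] ℚ_[p][G] r) • (show RatSpan p U from (1 : ℚ_[p]) ⊗ₜ[ℤ_[p]] u)
    induction r using MonoidAlgebra.induction_on with
    | of g =>
      change _ = (ratRep p G U).asAlgebraHom _ _
      rw [MonoidAlgebra.algebraMap_def, MonoidAlgebra.of_apply, MonoidAlgebra.mapRingHom_single,
        map_one, Representation.asAlgebraHom_single, one_smul]
      rfl
    | add a b ha hb =>
      rw [add_smul, TensorProduct.tmul_add, ha, hb, map_add, add_smul]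
      rfl
    | smul a r hr =>
      have h1 : algebraMap ℤ_[p][G] ℚ_[p][G] (a • r) =
          (a : ℚ_[p]) • algebraMap ℤ_[p][G] ℚ_[p][G] r := by
        ext g
        simp [Algebra.smul_def]
      rw [smul_assoc, h1]
      change _ = (ratRep p G U).asAlgebraHom _ _
      rw [map_smul, LinearMap.smul_apply]
      change _ = (a : ℚ_[p]) • (algebraMap ℤ_[p][G] ℚ_[p][G] r •
        (show RatSpan p U from (1 : ℚ_[p]) ⊗ₜ[ℤ_[p]] u))
      rw [← hr]
      change _ = (a : ℚ_[p]) • (1 : ℚ_[p]) ⊗ₜ[ℤ_[p]] (r • u)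
      rw [← TensorProduct.smul_tmul, TensorProduct.smul_tmul']
      rfl

/-- The copy `1 ⊗ U` of `U` in `ℚ_p U`. -/
def lat : Submodule ℤ_[p][G] (RatSpan p U) :=
  LinearMap.range (toRatSpan p G U)

variable {G}

/-- `U_(i) = e_i U`, inside `ℚ_p U`. -/
def latPart (i : Idx p G) : Submodule ℤ_[p][G] (RatSpan p U) :=
  (lat p G U).map (DistribSMul.toLinearMap ℤ_[p][G] (RatSpan p U) (idem p i))

variable (G)

/-- `U_* = ∑_i U_(i)`. -/
def latStar : Submodule ℤ_[p][G] (RatSpan p U) :=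
  ⨆ i : Idx p G, latPart p U i

/-- The space `V = U_* / U` of the diagram of `U`. -/
abbrev DiagramSpace : Type _ :=
  latStar p G U ⧸ (lat p G U).submoduleOf (latStar p G U)

variable {G}

/-- The submodule `V_(i) = (U_(i) + U) / U` of `V = U_* / U`, for `i ∈ I`. -/
def diagramPart (i : Idx p G) : Submodule ℤ_[p][G] (DiagramSpace p G U) :=
  ((latPart p U i).submoduleOf (latStar p G U)).map
    ((lat p G U).submoduleOf (latStar p G U)).mkQ

/-- The `N`-invariants `M^N` of a `ℤ_p G`-module `M`. -/
def invariants (N : Subgroup G) (M : Type*) [AddCommGroup M] [Module ℤ_[p][G] M] :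
    Submodule ℤ_[p][G] M where
  carrier := {m | ∀ n ∈ N, MonoidAlgebra.of ℤ_[p] G n • m = m}
  zero_mem' := fun _ _ => smul_zero _
  add_mem' := fun hx hy n hn => by rw [smul_add, hx n hn, hy n hn]
  smul_mem' := fun r x hx n hn => by rw [smul_comm, hx n hn]

/-- The `N`-coinvariants `M_N = M / I_N M` of a `ℤ_p G`-module `M`. -/
abbrev Coinvariants (N : Subgroup G) (M : Type*) [AddCommGroup M] [Module ℤ_[p][G] M] : Type _ :=
  M ⧸ (augIdeal p N • (⊤ : Submodule ℤ_[p][G] M))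

/-- The restriction of `U` to the subgroup `N` is a permutation module: `U` has a finite
`ℤ_p`-basis that is preserved setwise by multiplication by the elements of `N`. -/
def IsPermutationRestrictedTo (N : Subgroup G) : Prop :=
  ∃ (d : ℕ) (b : Module.Basis (Fin d) ℤ_[p] U),
    ∀ n ∈ N, ∀ i, ∃ j, MonoidAlgebra.of ℤ_[p] G n • b i = b j

end Lattice

end

end ButlerLattice

namespace ButlerLattice

/-! Fix a generator `n` of `N` and let `T = 1 + n + ⋯ + n ^ (p - 1)`. Both equivalences pass through
`NormKernelTrivial`: on `U`, the kernel of `T` is the image of `n - 1`, that is, a Tate cohomology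
group of `N` vanishes.

Coinvariants. `T` is congruent to `p` modulo `n - 1`, and `T (n - 1) = 0`; so for torsion-free `U`
the quotient of `ker T` by `(n - 1) U` is exactly the torsion of `U_N`
(`isLattice_coinvariants_iff`).

Permutation bases. On a module killed by `T`, the operators `(n - 1) ^ (p - 1)` and `p` have the
same image (`range_sub_one_pow`), so `n - 1` behaves like the uniformizer of the `p`-th cyclotomic
extension of `ℤ_p`. Index counting and Nakayama for `n - 1` then replace the structure theory over
that ring: generators of suitable finite quotients of `U` lift to a spanning family of free orbits
and fixed vectors, and its size equals the rank (`exists_basis_permuted`).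

Diagrams. If the kernel condition holds, each containment comes from lifting an element of `V` to
`U_*`, forming an element of `U` killed by `T`, and dividing it by `n - 1` in `U`. Conversely, let
`w` in `U` be killed by `T`. Its components at `0` and `N` vanish, so condition 1 puts each
remaining component `e_H w` in `(n - 1) U_(H)` up to an error in `U ∩ U_(H)`. Reducedness forces the
error into `(n - 1) U_(H)` as well, since otherwise it would generate a summand `Λ_(H)`
(`exists_isCompl_equiv_Lam`). Thus `w = (n - 1) x` with `x` in `U_*`, and condition 2 corrects `x`
to an element of `U` without changing `(n - 1) x`. -/

open scoped Polynomial in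
/-- Modulo `p`, the `p`-th cyclotomic polynomial is `(X - 1) ^ (p - 1)`; the error term has value
`-p` at `1`. -/
theorem exists_X_sub_one_pow_eq (p : ℕ) [hp : Fact p.Prime] :
    ∃ q : ℤ[X], (Polynomial.X - 1 : ℤ[X]) ^ (p - 1) =
      ∑ j ∈ Finset.range p, Polynomial.X ^ j +
        (p : ℤ[X]) * ((Polynomial.X - 1) * q - 1) := by
  have hp1 : p - 1 + 1 = p := Nat.succ_pred_prime hp.out
  have h1 : ∃ r : ℤ[X], (Polynomial.X - 1 : ℤ[X]) ^ (p - 1) -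
      ∑ j ∈ Finset.range p, Polynomial.X ^ j = (p : ℤ[X]) * r := by
    have h0 : Polynomial.map (Int.castRingHom (ZMod p))
        ((Polynomial.X - 1 : ℤ[X]) ^ (p - 1) - ∑ j ∈ Finset.range p, Polynomial.X ^ j) = 0 := by
      have hX : (Polynomial.X - 1 : (ZMod p)[X]) ≠ 0 := Polynomial.X_sub_C_ne_zero 1
      have h2 : (Polynomial.X - 1 : (ZMod p)[X]) ^ (p - 1) -
          ∑ j ∈ Finset.range p, Polynomial.X ^ j = 0 := by
        apply mul_right_cancel₀ hX
        rw [sub_mul, geom_sum_mul, ← pow_succ, hp1, sub_pow_char]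
        simp
      simpa [Polynomial.map_sum] using h2
    have h3 : (Polynomial.C (p : ℤ)) ∣ ((Polynomial.X - 1 : ℤ[X]) ^ (p - 1) -
        ∑ j ∈ Finset.range p, Polynomial.X ^ j) := by
      rw [Polynomial.C_dvd_iff_dvd_coeff]
      intro i
      rw [← ZMod.intCast_zmod_eq_zero_iff_dvd]
      have := congrArg (fun f => Polynomial.coeff f i) h0
      rw [Polynomial.coeff_map, Polynomial.coeff_zero] at this
      exact this
    obtain ⟨r, hr⟩ := h3
    exact ⟨r, by rw [hr]; simp⟩
  obtain ⟨r, hr⟩ := h1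
  -- At `1` the power vanishes and the geometric sum is `p`, which determines `r` modulo `X - 1`.
  have hr1 : Polynomial.eval 1 r = -1 := by
    have := congrArg (Polynomial.eval 1) hr
    have h4 : p - 1 ≠ 0 := Nat.sub_ne_zero_of_lt hp.out.one_lt
    have h5 : (p : ℤ) ≠ 0 := by exact_mod_cast hp.out.ne_zero
    simp [Polynomial.eval_finsetSum, h4] at this
    apply mul_left_cancel₀ h5
    linarith
  have h6 : (Polynomial.X - Polynomial.C 1) ∣ r + 1 := by
    rw [Polynomial.dvd_iff_isRoot]
    simp [hr1]
  obtain ⟨q, hq⟩ := h6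
  refine ⟨q, ?_⟩
  rw [map_one] at hq
  rw [← hq]
  linear_combination hr

variable {p : ℕ} [hp : Fact p.Prime]

/-! ### Indices and generators in `ℤ_p`-lattices. -/

section Index

variable {M : Type*} [AddCommGroup M] [Module ℤ_[p] M]

/-- Reducing coordinates modulo `p` identifies `M / pM` with a vector space over `ZMod p` of
dimension the rank. -/
theorem index_smul_top [Module.Finite ℤ_[p] M] [Module.Free ℤ_[p] M] :
    (LinearMap.range ((p : ℤ_[p]) • LinearMap.id : M →ₗ[ℤ_[p]] M)).toAddSubgroup.index =
      p ^ Module.finrank ℤ_[p] M := by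
  let b := Module.finBasis ℤ_[p] M
  let f : M →+ (Fin (Module.finrank ℤ_[p] M) → ZMod p) :=
    { toFun := fun x i => PadicInt.toZMod (b.repr x i)
      map_zero' := by ext; simp
      map_add' := fun x y => by ext; simp }
  have hker : f.ker =
      (LinearMap.range ((p : ℤ_[p]) • LinearMap.id : M →ₗ[ℤ_[p]] M)).toAddSubgroup := by
    ext x
    rw [AddMonoidHom.mem_ker]
    constructor
    · intro h
      have h1 : ∀ i, ∃ c, b.repr x i = p * c := fun i => by
        have : PadicInt.toZMod (b.repr x i) = 0 := congrFun h i
        rw [← RingHom.mem_ker, PadicInt.ker_toZMod, PadicInt.maximalIdeal_eq_span_p,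
          Ideal.mem_span_singleton] at this
        exact this
      choose c hc using h1
      refine ⟨∑ i, c i • b i, ?_⟩
      rw [← b.sum_repr x]
      simp only [hc, mul_smul, LinearMap.smul_apply, LinearMap.id_apply, Finset.smul_sum]
    · rintro ⟨y, rfl⟩
      ext i
      simp [f]
  have hsurj : Function.Surjective f := fun v => by
    choose c hc using fun i => ZMod.ringHom_surjective (PadicInt.toZMod (p := p)) (v i)
    refine ⟨∑ i, c i • b i, ?_⟩
    ext i
    change PadicInt.toZMod (b.repr (∑ i, c i • b i) i) = v i
    rw [b.repr_sum_self, hc]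
  rw [← hker, AddSubgroup.index_ker, AddMonoidHom.range_eq_top.2 hsurj]
  simp

theorem exists_span_range_eq_top_of_zmod {Q : Type*} [AddCommGroup Q] [Module ℤ_[p] Q]
    [Module (ZMod p) Q] {c : ℕ} (hcard : Nat.card Q = p ^ c) :
    ∃ z : Fin c → Q, Submodule.span ℤ_[p] (Set.range z) = ⊤ := by
  have : Finite Q := Nat.finite_of_card_ne_zero (by rw [hcard]; exact pow_ne_zero _ hp.out.ne_zero)
  have hrank : Module.finrank (ZMod p) Q = c := by
    rw [← FiniteField.pow_finrank_eq_natCard p] at hcard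
    exact Nat.pow_right_injective hp.out.two_le hcard
  let b := Module.finBasisOfFinrankEq (ZMod p) Q hrank
  refine ⟨b, eq_top_iff.2 fun x _ => ?_⟩
  rw [← b.sum_repr x]
  refine Submodule.sum_mem _ fun k _ => ?_
  rw [← ZMod.natCast_zmod_val (b.repr x k), Nat.cast_smul_eq_nsmul]
  exact Submodule.smul_of_tower_mem _ _ (Submodule.subset_span ⟨k, rfl⟩)

theorem exists_span_range_eq_top {Q : Type*} [AddCommGroup Q] [Module ℤ_[p] Q]
    (hkill : ∀ x : Q, p • x = 0) {c : ℕ} (hcard : Nat.card Q = p ^ c) :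
    ∃ z : Fin c → Q, Submodule.span ℤ_[p] (Set.range z) = ⊤ :=
  let := AddCommGroup.zmodModule hkill
  exists_span_range_eq_top_of_zmod hcard

/-- If `A` has `p`-power index `p ^ c` in `B` and contains `pB`, then `B` is generated by `A`
and `c` elements. -/
theorem exists_le_span_sup {A B : Submodule ℤ_[p] M}
    (hB : ∀ x ∈ B, (p : ℤ_[p]) • x ∈ A) {c : ℕ}
    (hc : A.toAddSubgroup.relIndex B.toAddSubgroup = p ^ c) :
    ∃ z : Fin c → M, (∀ k, z k ∈ B) ∧ B ≤ Submodule.span ℤ_[p] (Set.range z) ⊔ A := by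
  have hkill : ∀ x : B ⧸ A.submoduleOf B, p • x = 0 := fun x => by
    obtain ⟨y, rfl⟩ := Submodule.mkQ_surjective _ x
    rw [← Nat.cast_smul_eq_nsmul ℤ_[p], ← map_smul, Submodule.mkQ_apply,
      Submodule.Quotient.mk_eq_zero]
    exact hB y y.2
  obtain ⟨b, hb⟩ := exists_span_range_eq_top hkill hc
  choose z hz using fun k => Submodule.mkQ_surjective (A.submoduleOf B) (b k)
  refine ⟨fun k => z k, fun k => (z k).2, fun x hx => ?_⟩
  have h1 : (A.submoduleOf B).mkQ ⟨x, hx⟩ ∈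
      (Submodule.span ℤ_[p] (Set.range z)).map (A.submoduleOf B).mkQ := by
    rw [Submodule.map_span, ← Set.range_comp, show (A.submoduleOf B).mkQ ∘ z = b from funext hz, hb]
    trivial
  obtain ⟨y, hy, hyx⟩ := h1
  rw [Submodule.mkQ_apply, Submodule.mkQ_apply, Submodule.Quotient.eq] at hyx
  have h2 : x = (y : M) - ((y : M) - x) := by abel
  rw [h2]
  refine Submodule.sub_mem _ (Submodule.mem_sup_left ?_) (Submodule.mem_sup_right hyx)
  have h3 := Submodule.mem_map_of_mem (f := B.subtype) hy
  rw [Submodule.map_span, ← Set.range_comp] at h3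
  exact h3

/-- Nakayama's lemma over the local ring `ℤ_p`. -/
theorem eq_top_of_sup_smul_eq_top [Module.Finite ℤ_[p] M] {S : Submodule ℤ_[p] M}
    (h : ∀ x, ∃ s ∈ S, ∃ y, x = s + (p : ℤ_[p]) • y) : S = ⊤ := by
  rw [eq_top_iff]
  refine Submodule.le_of_le_smul_of_le_jacobson_bot (I := IsLocalRing.maximalIdeal ℤ_[p])
    Module.Finite.fg_top (IsLocalRing.maximalIdeal_le_jacobson _) fun x _ => ?_
  obtain ⟨s, hs, y, rfl⟩ := h x
  refine Submodule.add_mem _ (Submodule.mem_sup_left hs) (Submodule.mem_sup_right ?_)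
  refine Submodule.smul_mem_smul ?_ trivial
  rw [PadicInt.maximalIdeal_eq_span_p]
  exact Ideal.mem_span_singleton_self _

/-- The kernel has rank zero and sits in a torsion-free module. -/
theorem injective_of_surjective_of_finrank_le {L : Type*} [AddCommGroup L] [Module ℤ_[p] L]
    [Module.Finite ℤ_[p] L] [Module.IsTorsionFree ℤ_[p] L] (f : L →ₗ[ℤ_[p]] M)
    (hf : Function.Surjective f) (h : Module.finrank ℤ_[p] L ≤ Module.finrank ℤ_[p] M) :
    Function.Injective f := by
  have h1 := Submodule.finrank_quotient_add_finrank (LinearMap.ker f)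
  rw [(f.quotKerEquivOfSurjective hf).finrank_eq] at h1
  rw [← LinearMap.ker_eq_bot, ← Submodule.finrank_eq_zero (R := ℤ_[p])]
  omega

end Index

/-! ### Operators killed by the `p`-th cyclotomic polynomial. -/

section Cyclotomic

variable {M : Type*} [AddCommGroup M] [Module ℤ_[p] M] (ν : Module.End ℤ_[p] M)

theorem exists_sub_one_pow_eq : ∃ e : Module.End ℤ_[p] M, Commute (ν - 1) e ∧
    (ν - 1) ^ (p - 1) =
      ∑ j ∈ Finset.range p, ν ^ j + (p : Module.End ℤ_[p] M) * ((ν - 1) * e - 1) := by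
  obtain ⟨q, hq⟩ := exists_X_sub_one_pow_eq p
  refine ⟨Polynomial.aeval ν q, ?_, by simpa using congrArg (Polynomial.aeval ν) hq⟩
  have := (Commute.all (Polynomial.X - 1) q).map (Polynomial.aeval ν)
  rwa [map_sub, Polynomial.aeval_X, map_one] at this

theorem map_sub_one_mem {S : Submodule ℤ_[p] M} (hS : ∀ x ∈ S, ν x ∈ S) {x : M} (hx : x ∈ S) :
    (ν - 1) x ∈ S :=
  Submodule.sub_mem _ (hS x hx) hx

theorem pow_map_mem {S : Submodule ℤ_[p] M} (hS : ∀ x ∈ S, ν x ∈ S) {x : M} (hx : x ∈ S) (k : ℕ) :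
    (ν ^ k) x ∈ S := by
  induction k with
  | zero => simpa
  | succ k ih =>
    rw [pow_succ', Module.End.mul_apply]
    exact hS _ ih

variable {ν}

/-- The analogue of total ramification: `(ν - 1) ^ (p - 1) = p (E - 1)` with `E` divisible by `ν -
1`, so `E - 1` behaves like a unit. -/
theorem range_sub_one_pow (hν : ∑ j ∈ Finset.range p, ν ^ j = 0) :
    LinearMap.range ((ν - 1) ^ (p - 1)) =
      LinearMap.range ((p : ℤ_[p]) • LinearMap.id : M →ₗ[ℤ_[p]] M) := by
  obtain ⟨e, hc, he⟩ := exists_sub_one_pow_eq ν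
  rw [hν, zero_add] at he
  apply le_antisymm
  · rintro _ ⟨x, rfl⟩
    refine ⟨((ν - 1) * e - 1) x, ?_⟩
    rw [he]
    simp [Module.End.mul_apply, Nat.cast_smul_eq_nsmul]
  · rintro _ ⟨x, rfl⟩
    let E := (ν - 1) * e
    -- A finite geometric sum avoids inverting `E - 1`: the remainder `p E ^ (p - 1)` is already
    -- divisible by `(ν - 1) ^ (p - 1)`.
    have h1 : (p : Module.End ℤ_[p] M) = (ν - 1) ^ (p - 1) *
        ((p : Module.End ℤ_[p] M) * e ^ (p - 1) - ∑ j ∈ Finset.range (p - 1), E ^ j) := by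
      have h2 : (E - 1) * ∑ j ∈ Finset.range (p - 1), E ^ j = E ^ (p - 1) - 1 := mul_geom_sum _ _
      have h3 : E ^ (p - 1) = (ν - 1) ^ (p - 1) * e ^ (p - 1) := hc.mul_pow _
      have h4 : (p : Module.End ℤ_[p] M) * ((E - 1) * ∑ j ∈ Finset.range (p - 1), E ^ j) =
        p * E ^ (p - 1) - p := by rw [h2, mul_sub, mul_one]
      rw [← mul_assoc, ← he] at h4
      rw [mul_sub, h4, ← mul_assoc, ← Nat.cast_comm, mul_assoc, ← h3]
      abel
    refine ⟨((p : Module.End ℤ_[p] M) * e ^ (p - 1) - ∑ j ∈ Finset.range (p - 1), E ^ j) x, ?_⟩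
    rw [← Module.End.mul_apply, ← h1]
    simp [Nat.cast_smul_eq_nsmul]

theorem smul_mem_range_sub_one (hν : ∑ j ∈ Finset.range p, ν ^ j = 0) (x : M) :
    (p : ℤ_[p]) • x ∈ LinearMap.range (ν - 1) := by
  have h1 : (p : ℤ_[p]) • x ∈ LinearMap.range ((ν - 1) ^ (p - 1)) := by
    rw [range_sub_one_pow hν]
    exact ⟨x, rfl⟩
  obtain ⟨y, hy⟩ := h1
  obtain ⟨k, hk⟩ := Nat.exists_eq_add_of_lt hp.out.one_lt
  rw [show p - 1 = k + 1 by omega, pow_succ', Module.End.mul_apply] at hy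
  exact ⟨_, hy⟩

theorem sub_one_injective [Module.IsTorsionFree ℤ_[p] M]
    (hν : ∑ j ∈ Finset.range p, ν ^ j = 0) : Function.Injective (ν - 1 : Module.End ℤ_[p] M) := by
  rw [← LinearMap.ker_eq_bot, LinearMap.ker_eq_bot']
  intro x hx
  have h1 : ν x = x := sub_eq_zero.1 hx
  have h2 : ∀ j, (ν ^ j) x = x := fun j => by
    induction j with
    | zero => rfl
    | succ j ih => rw [pow_succ, Module.End.mul_apply, h1, ih]
  have h3 := congrArg (fun f => f x) hν
  simp only [LinearMap.sum_apply, h2, Finset.sum_const, Finset.card_range,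
    LinearMap.zero_apply] at h3
  rw [← Nat.cast_smul_eq_nsmul ℤ_[p]] at h3
  exact (smul_eq_zero.1 h3).resolve_left (by exact_mod_cast hp.out.ne_zero)

/-- Since `ν - 1` is injective, each application multiplies the index by the same factor. -/
theorem index_range_sub_one_pow [Module.IsTorsionFree ℤ_[p] M]
    (hν : ∑ j ∈ Finset.range p, ν ^ j = 0) (k : ℕ) :
    (LinearMap.range ((ν - 1) ^ k)).toAddSubgroup.index =
      (LinearMap.range (ν - 1)).toAddSubgroup.index ^ k := by
  induction k with
  | zero => simp [Module.End.one_eq_id]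
  | succ k ih =>
    have h1 : (LinearMap.range ((ν - 1) ^ (k + 1))).toAddSubgroup =
        AddSubgroup.map (ν - 1).toAddMonoidHom (LinearMap.range ((ν - 1) ^ k)).toAddSubgroup := by
      rw [pow_succ', Module.End.mul_eq_comp, LinearMap.range_comp]
      rfl
    rw [h1, AddSubgroup.index_map_of_injective _ (sub_one_injective hν), ih, pow_succ]
    rfl

/-- Compare two values of the index of `pM`: `p` to the rank, and the `(p - 1)`-st power of the
index of `(ν - 1) M`. Here `b` plays the role of the rank over the cyclotomic ring. -/
theorem exists_finrank_eq_and_index_eq [Module.Finite ℤ_[p] M] [Module.Free ℤ_[p] M]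
    (hν : ∑ j ∈ Finset.range p, ν ^ j = 0) :
    ∃ b : ℕ, Module.finrank ℤ_[p] M = (p - 1) * b ∧
      (LinearMap.range (ν - 1)).toAddSubgroup.index = p ^ b := by
  have h1 := index_range_sub_one_pow hν (p - 1)
  rw [range_sub_one_pow hν, index_smul_top] at h1
  have hp1 : p - 1 ≠ 0 := Nat.sub_ne_zero_of_lt hp.out.one_lt
  obtain ⟨b, -, hb⟩ := (Nat.dvd_prime_pow hp.out).1 (h1 ▸ dvd_pow_self _ hp1)
  refine ⟨b, ?_, hb⟩
  rw [hb, ← pow_mul] at h1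
  rw [mul_comm]
  exact Nat.pow_right_injective hp.out.two_le h1

/-- Nakayama for `ν - 1`: iterating the hypothesis `p - 1` times gives it for `p`. -/
theorem eq_top_of_sup_range_sub_one_eq_top [Module.Finite ℤ_[p] M]
    (hν : ∑ j ∈ Finset.range p, ν ^ j = 0) {S : Submodule ℤ_[p] M} (hS : ∀ x ∈ S, ν x ∈ S)
    (h : ∀ x, ∃ s ∈ S, ∃ y : M, x = s + (ν - 1) y) : S = ⊤ := by
  have h1 : ∀ (k : ℕ) (x : M), ∃ s ∈ S, ∃ y : M, x = s + ((ν - 1) ^ k) y := by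
    intro k
    induction k with
    | zero => exact fun x => ⟨0, S.zero_mem, x, by simp⟩
    | succ k ih =>
      intro x
      obtain ⟨s, hs, y, rfl⟩ := h x
      obtain ⟨t, ht, z, rfl⟩ := ih y
      refine ⟨s + (ν - 1) t, S.add_mem hs (map_sub_one_mem ν hS ht), z, ?_⟩
      rw [map_add, pow_succ', Module.End.mul_apply, add_assoc]
  refine eq_top_of_sup_smul_eq_top fun x => ?_
  obtain ⟨s, hs, y, hy⟩ := h1 (p - 1) x
  have h2 : ((ν - 1) ^ (p - 1)) y ∈
      LinearMap.range ((p : ℤ_[p]) • LinearMap.id : M →ₗ[ℤ_[p]] M) := by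
    rw [← range_sub_one_pow hν]
    exact ⟨y, rfl⟩
  obtain ⟨z, hz⟩ := h2
  exact ⟨s, hs, z, by rw [hy, ← hz]; rfl⟩

variable (ν) in
/-- The span of the vectors `ν ^ j (v i)` for `j < p - 1`. -/
noncomputable def orbitSpan {ι : Type*} (v : ι → M) : Submodule ℤ_[p] M :=
  Submodule.span ℤ_[p] (Set.range fun x : Fin (p - 1) × ι => (ν ^ (x.1 : ℕ)) (v x.2))

theorem mem_orbitSpan {ι : Type*} (v : ι → M) (i : ι) : v i ∈ orbitSpan ν v :=
  Submodule.subset_span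
    ⟨(⟨0, Nat.sub_pos_of_lt hp.out.one_lt⟩, i), by simp⟩

/-- The vanishing norm rewrites `ν ^ (p - 1)` through lower powers, so `p - 1` vectors per generator
suffice. -/
theorem map_mem_orbitSpan (hν : ∑ j ∈ Finset.range p, ν ^ j = 0) {ι : Type*} (v : ι → M) :
    ∀ x ∈ orbitSpan ν v, ν x ∈ orbitSpan ν v := by
  have hp1 : p - 1 + 1 = p := Nat.succ_pred_prime hp.out
  intro x hx
  induction hx using Submodule.span_induction with
  | zero => simp
  | add x y _ _ hx hy => rw [map_add]; exact Submodule.add_mem _ hx hy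
  | smul c x _ hx => rw [map_smul]; exact Submodule.smul_mem _ _ hx
  | mem x hx =>
    obtain ⟨⟨j, i⟩, rfl⟩ := hx
    have hmem : ∀ k < p - 1, (ν ^ k) (v i) ∈ orbitSpan ν v := fun k hk =>
      Submodule.subset_span ⟨(⟨k, hk⟩, i), rfl⟩
    rw [← Module.End.mul_apply, ← pow_succ']
    rcases Nat.lt_or_ge ((j : ℕ) + 1) (p - 1) with h | h
    · exact hmem _ h
    · have h1 : (j : ℕ) + 1 = p - 1 := by have := j.2; omega
      rw [show Finset.range p = Finset.range (p - 1 + 1) by rw [hp1], Finset.sum_range_succ] at hν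
      have h2 := congrArg (fun f => f (v i)) hν
      simp only [LinearMap.add_apply, LinearMap.sum_apply, LinearMap.zero_apply] at h2
      simp only [h1]
      rw [eq_neg_of_add_eq_zero_right h2]
      exact Submodule.neg_mem _ (Submodule.sum_mem _ fun k hk =>
        hmem k (Finset.mem_range.1 hk))

theorem finrank_orbitSpan_le {ι : Type*} [Fintype ι] (v : ι → M) :
    Module.finrank ℤ_[p] (orbitSpan ν v) ≤ (p - 1) * Fintype.card ι := by
  have := finrank_range_le_card (R := ℤ_[p])
    (fun x : Fin (p - 1) × ι => (ν ^ (x.1 : ℕ)) (v x.2))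
  rw [Fintype.card_prod, Fintype.card_fin] at this
  exact this

/-- A vector outside the image of `ν - 1` generates a `ν`-stable direct summand of rank
`p - 1`. -/
theorem exists_isCompl_orbitSpan [Module.Finite ℤ_[p] M] [Module.Free ℤ_[p] M]
    (hν : ∑ j ∈ Finset.range p, ν ^ j = 0) {u : M} (hu : u ∉ LinearMap.range (ν - 1)) :
    ∃ C : Submodule ℤ_[p] M, (∀ x ∈ C, ν x ∈ C) ∧
      IsCompl (orbitSpan ν fun _ : Unit => u) C ∧
      Module.finrank ℤ_[p] (orbitSpan ν fun _ : Unit => u) = p - 1 := by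
  obtain ⟨b, hrank, hindex⟩ := exists_finrank_eq_and_index_eq hν
  have hkill := smul_mem_range_sub_one hν
  -- As `u` is nonzero in `M / (ν - 1) M`, of order `p ^ b`, the quotient by `A₀` needs only `k < b`
  -- further generators.
  let A₀ : Submodule ℤ_[p] M := Submodule.span ℤ_[p] {u} ⊔ LinearMap.range (ν - 1)
  have hle : (LinearMap.range (ν - 1)).toAddSubgroup ≤ A₀.toAddSubgroup :=
    (le_sup_right : LinearMap.range (ν - 1) ≤ A₀)
  have hmul := AddSubgroup.relIndex_mul_index hle
  rw [hindex] at hmul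
  obtain ⟨k, -, hk⟩ := (Nat.dvd_prime_pow hp.out).1 (Dvd.intro_left _ hmul)
  obtain ⟨l, -, hl⟩ := (Nat.dvd_prime_pow hp.out).1 (Dvd.intro _ hmul)
  have hl0 : l ≠ 0 := by
    rintro rfl
    rw [pow_zero, AddSubgroup.relIndex_eq_one] at hl
    exact hu (hl (show u ∈ A₀ from
      Submodule.mem_sup_left (Submodule.mem_span_singleton_self u)))
  have hkl : l + k = b := by
    rw [hk, hl, ← pow_add] at hmul
    exact Nat.pow_right_injective hp.out.two_le hmul
  have hk' : A₀.toAddSubgroup.relIndex (⊤ : Submodule ℤ_[p] M).toAddSubgroup = p ^ k := by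
    rw [← hk]
    exact AddSubgroup.relIndex_top_right _
  obtain ⟨z, -, hz⟩ := exists_le_span_sup
    (fun x _ => Submodule.mem_sup_right (hkill x)) hk'
  let A := orbitSpan ν fun _ : Unit => u
  let C := orbitSpan ν z
  have hsup : A ⊔ C = ⊤ := by
    refine eq_top_of_sup_range_sub_one_eq_top hν (fun x hx => ?_) fun x => ?_
    · obtain ⟨a, ha, c, hc, rfl⟩ := Submodule.mem_sup.1 hx
      rw [map_add]
      exact Submodule.add_mem _ (Submodule.mem_sup_left (map_mem_orbitSpan hν _ _ ha))
        (Submodule.mem_sup_right (map_mem_orbitSpan hν _ _ hc))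
    · obtain ⟨s, hs, t, ht, rfl⟩ := Submodule.mem_sup.1 (hz (Submodule.mem_top (x := x)))
      obtain ⟨r, hr, _, ⟨y, rfl⟩, rfl⟩ := Submodule.mem_sup.1 ht
      refine ⟨r + s, Submodule.add_mem _ (Submodule.mem_sup_left ?_)
        (Submodule.mem_sup_right ?_), y, by abel⟩
      · refine (Submodule.span_le.2 ?_ : Submodule.span ℤ_[p] {u} ≤ A) hr
        exact Set.singleton_subset_iff.2 (mem_orbitSpan (fun _ : Unit => u) ())
      · refine (Submodule.span_le.2 ?_ : Submodule.span ℤ_[p] (Set.range z) ≤ C) hs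
        rintro _ ⟨i, rfl⟩
        exact mem_orbitSpan z i
  have hA : Module.finrank ℤ_[p] A ≤ p - 1 := by
    simpa using finrank_orbitSpan_le (ν := ν) fun _ : Unit => u
  have hC : Module.finrank ℤ_[p] C ≤ (p - 1) * k := by
    simpa using finrank_orbitSpan_le (ν := ν) z
  let f : (A × C) →ₗ[ℤ_[p]] M := A.subtype.coprod C.subtype
  have hf : Function.Surjective f := by
    rw [← LinearMap.range_eq_top, LinearMap.range_coprod, Submodule.range_subtype,
      Submodule.range_subtype, hsup]
  have hfin : Module.finrank ℤ_[p] (A × C) =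
      Module.finrank ℤ_[p] A + Module.finrank ℤ_[p] C := Module.finrank_prod
  -- The rank bounds for `A` and `C` add up to at most the rank of `M`, so the surjection from `A ×
  -- C` is injective and both bounds are attained where needed.
  have hb : (p - 1) * (1 + k) ≤ (p - 1) * b := Nat.mul_le_mul_left _ (by omega)
  have hge := LinearMap.finrank_le_finrank_of_surjective hf
  have hinj := injective_of_surjective_of_finrank_le f hf (by rw [hfin, hrank]; linarith)
  refine ⟨C, map_mem_orbitSpan hν z, ⟨?_, codisjoint_iff.2 hsup⟩, by
    change Module.finrank ℤ_[p] A = _; linarith⟩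
  rw [Submodule.disjoint_def]
  intro x hxA hxC
  have h1 : f (⟨x, hxA⟩, -⟨x, hxC⟩) = f 0 := by simp [f]
  simpa using congrArg (fun y => (y.1 : M)) (hinj h1)

end Cyclotomic

/-! ### Norm kernels and permutation bases. -/

section Permutation

variable {U : Type*} [AddCommGroup U] [Module ℤ_[p] U] {ν : Module.End ℤ_[p] U}

theorem norm_sub_one_apply (hν : ν ^ p = 1) (x : U) :
    (∑ j ∈ Finset.range p, ν ^ j) ((ν - 1) x) = 0 := by
  rw [← Module.End.mul_apply, geom_sum_mul, hν, sub_self, LinearMap.zero_apply]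

theorem norm_map_apply (hν : ν ^ p = 1) (x : U) :
    (∑ j ∈ Finset.range p, ν ^ j) (ν x) = (∑ j ∈ Finset.range p, ν ^ j) x := by
  have := norm_sub_one_apply hν x
  rwa [LinearMap.sub_apply, Module.End.one_apply, map_sub, sub_eq_zero] at this

/-- A lattice with an operator `ν` of order `p` such that the kernel of the norm
`1 + ν + ⋯ + ν ^ (p - 1)` is the image of `ν - 1` has a basis permuted by `ν`. -/
theorem exists_basis_permuted [Module.Finite ℤ_[p] U] [Module.Free ℤ_[p] U] (hν : ν ^ p = 1)
    (hW : ∀ x, (∑ j ∈ Finset.range p, ν ^ j) x = 0 → ∃ y, x = (ν - 1) y) :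
    ∃ (d : ℕ) (b : Module.Basis (Fin d) ℤ_[p] U), ∀ i, ∃ j, ν (b i) = b j := by
  let T : Module.End ℤ_[p] U := ∑ j ∈ Finset.range p, ν ^ j
  let W : Submodule ℤ_[p] U := LinearMap.ker T
  have hstab : ∀ x ∈ W, ν x ∈ W := fun x hx => (norm_map_apply hν x).trans hx
  have hrange : LinearMap.range (ν - 1) = W := by
    apply le_antisymm
    · rintro _ ⟨x, rfl⟩
      exact norm_sub_one_apply hν x
    · intro x hx
      obtain ⟨y, hy⟩ := hW x hx
      exact ⟨y, hy.symm⟩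
  let ω : Module.End ℤ_[p] W := ν.restrict hstab
  have hωpow : ∀ (j : ℕ) (w : W), ((ω ^ j) w : U) = (ν ^ j) w := fun j w => by
    induction j with
    | zero => rfl
    | succ j ih => rw [pow_succ', pow_succ', Module.End.mul_apply, Module.End.mul_apply, ← ih]; rfl
  have hω : ∑ j ∈ Finset.range p, ω ^ j = 0 := by
    ext w
    have h1 : T w = 0 := w.2
    simp only [T, LinearMap.sum_apply] at h1
    simp [LinearMap.sum_apply, hωpow, h1]
  obtain ⟨b, hWrank, hWindex⟩ := exists_finrank_eq_and_index_eq hω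
  let D : Submodule ℤ_[p] U := W.map (ν - 1)
  have hD : D.toAddSubgroup.relIndex W.toAddSubgroup = p ^ b := by
    rw [← hWindex]
    refine congrArg AddSubgroup.index (AddSubgroup.ext fun w => ?_)
    constructor
    · rintro ⟨y, hy, hyw⟩
      exact ⟨⟨y, hy⟩, Subtype.ext hyw⟩
    · rintro ⟨y, rfl⟩
      exact ⟨y, y.2, rfl⟩
  -- `X` is `W` plus the fixed vectors. The map `ν - 1` identifies `U / X` with `W / (ν - 1) W`, so
  -- `b` orbit generators will suffice.
  let X : Submodule ℤ_[p] U := D.comap (ν - 1)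
  have hX : X.toAddSubgroup.index = p ^ b := by
    rw [← hD, ← hrange]
    exact AddSubgroup.index_comap D.toAddSubgroup (ν - 1).toAddMonoidHom
  let P : Submodule ℤ_[p] U := LinearMap.range ((p : ℤ_[p]) • LinearMap.id : U →ₗ[ℤ_[p]] U)
  let Y : Submodule ℤ_[p] U := W ⊔ P
  have hpX : ∀ x : U, (p : ℤ_[p]) • x ∈ X := fun x => by
    have h1 : (ν - 1) x ∈ W := hrange ▸ LinearMap.mem_range_self _ x
    obtain ⟨y, hy⟩ := smul_mem_range_sub_one hω ⟨_, h1⟩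
    refine ⟨y, y.2, ?_⟩
    rw [map_smul]
    exact congrArg Subtype.val hy
  have hYX : Y ≤ X := by
    refine sup_le (fun x hx => ⟨x, hx, rfl⟩) ?_
    rintro _ ⟨x, rfl⟩
    exact hpX x
  let f := T.rangeRestrict
  have hf : Function.Surjective f := T.surjective_rangeRestrict
  have hrank : Module.finrank ℤ_[p] (LinearMap.range T) + Module.finrank ℤ_[p] W =
      Module.finrank ℤ_[p] U := by
    rw [← T.quotKerEquivRange.finrank_eq]
    exact Submodule.finrank_quotient_add_finrank W
  -- `T` carries `U / (W + pU)` isomorphically onto `T U / p T U`.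
  have hY : Y.toAddSubgroup.index = p ^ Module.finrank ℤ_[p] (LinearMap.range T) := by
    rw [← index_smul_top, ← AddSubgroup.index_comap_of_surjective (f := f.toAddMonoidHom) _ hf]
    refine congrArg AddSubgroup.index (AddSubgroup.ext fun x => ?_)
    constructor
    · intro hx
      obtain ⟨w, hw, _, ⟨y, rfl⟩, rfl⟩ := Submodule.mem_sup.1 hx
      refine ⟨f y, Subtype.ext ?_⟩
      have hw' : T w = 0 := hw
      simp [f, hw']
    · rintro ⟨⟨_, y, rfl⟩, hy⟩
      have h1 : T ((p : ℤ_[p]) • y) = T x := by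
        rw [map_smul]
        exact congrArg Subtype.val hy
      have h2 : x = (x - (p : ℤ_[p]) • y) + (p : ℤ_[p]) • y := by abel
      rw [h2]
      refine Submodule.add_mem _ (Submodule.mem_sup_left ?_) (Submodule.mem_sup_right ⟨y, rfl⟩)
      change T _ = 0
      rw [map_sub, h1, sub_self]
  have hle : Y.toAddSubgroup ≤ X.toAddSubgroup := hYX
  have hmul := AddSubgroup.relIndex_mul_index hle
  rw [hX, hY] at hmul
  obtain ⟨c, -, hc⟩ := (Nat.dvd_prime_pow hp.out).1 (Dvd.intro _ hmul)
  have hcb : c + b = Module.finrank ℤ_[p] (LinearMap.range T) := by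
    rw [hc, ← pow_add] at hmul
    exact Nat.pow_right_injective hp.out.two_le hmul
  obtain ⟨u, -, hu⟩ := exists_le_span_sup (A := X) (B := ⊤) (fun x _ => hpX x)
    ((AddSubgroup.relIndex_top_right _).trans hX)
  obtain ⟨z, hzX, hz⟩ := exists_le_span_sup
    (fun x _ => Submodule.mem_sup_right ⟨x, rfl⟩ : ∀ x ∈ X, (p : ℤ_[p]) • x ∈ Y) hc
  -- Subtracting `w k` from `z k` makes it fixed by `ν`, without changing its class modulo `W`.
  choose w hw hwz using fun k => hzX k
  let F : (Fin p × Fin b) ⊕ Fin c → U :=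
    Sum.elim (fun x => (ν ^ (x.1 : ℕ)) (u x.2)) (fun k => z k - w k)
  have hF : ∀ s, ∃ t, ν (F s) = F t := by
    rintro (⟨j, i⟩ | k)
    · rcases Nat.lt_or_ge ((j : ℕ) + 1) p with h | h
      · exact ⟨Sum.inl (⟨j + 1, h⟩, i), by simp [F, pow_succ', Module.End.mul_apply]⟩
      · refine ⟨Sum.inl (⟨0, hp.out.pos⟩, i), ?_⟩
        have h1 : (j : ℕ) + 1 = p := by have := j.2; omega
        simp only [F, Sum.elim_inl]
        rw [← Module.End.mul_apply, ← pow_succ', h1, hν, pow_zero]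
    · refine ⟨Sum.inr k, ?_⟩
      have h1 : (ν - 1) (z k - w k) = 0 := by rw [map_sub, hwz, sub_self]
      exact sub_eq_zero.1 h1
  let S : Submodule ℤ_[p] U := Submodule.span ℤ_[p] (Set.range F)
  have hS : ∀ x ∈ S, ν x ∈ S := by
    intro x hx
    induction hx using Submodule.span_induction with
    | zero => simp
    | add x y _ _ hx hy => rw [map_add]; exact Submodule.add_mem _ hx hy
    | smul c x _ hx => rw [map_smul]; exact Submodule.smul_mem _ _ hx
    | mem x hx =>
      obtain ⟨s, rfl⟩ := hx
      obtain ⟨t, ht⟩ := hF s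
      rw [ht]
      exact Submodule.subset_span ⟨t, rfl⟩
  have hspan : Submodule.span ℤ_[p] (Set.range u) ≤ S := by
    rw [Submodule.span_le]
    rintro _ ⟨i, rfl⟩
    exact Submodule.subset_span ⟨Sum.inl (⟨0, hp.out.pos⟩, i), by simp [F]⟩
  -- Modulo `X` the `u i` generate `U`, and `(ν - 1) X = (ν - 1) W`; hence `W = (ν - 1) U` lies in
  -- `S + (ν - 1) W`, and Nakayama applies.
  have hWS : W ≤ S := by
    have h1 : S.submoduleOf W = ⊤ := by
      refine eq_top_of_sup_range_sub_one_eq_top hω (fun x hx => hS x hx) fun x => ?_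
      obtain ⟨y, hy⟩ := hW x x.2
      obtain ⟨s, hs, t, ⟨v, hv, hvt⟩, rfl⟩ := Submodule.mem_sup.1 (hu (Submodule.mem_top (x := y)))
      have h2 : (ν - 1) s ∈ W := hrange ▸ LinearMap.mem_range_self _ s
      refine ⟨⟨(ν - 1) s, h2⟩, map_sub_one_mem ν hS (hspan hs), ⟨v, hv⟩, Subtype.ext ?_⟩
      rw [hy, map_add, ← hvt]
      rfl
    exact Submodule.submoduleOf_eq_top.1 h1
  have htop : S = ⊤ := by
    refine eq_top_of_sup_smul_eq_top fun x => ?_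
    obtain ⟨s, hs, t, ht, rfl⟩ := Submodule.mem_sup.1 (hu (Submodule.mem_top (x := x)))
    obtain ⟨r, hr, y, hy, rfl⟩ := Submodule.mem_sup.1 (hz ht)
    obtain ⟨v, hv, _, ⟨x, rfl⟩, rfl⟩ := Submodule.mem_sup.1 hy
    refine ⟨s + r + v, Submodule.add_mem _ (Submodule.add_mem _ (hspan hs) ?_) (hWS hv), x, ?_⟩
    · refine (Submodule.span_le.2 ?_ : Submodule.span ℤ_[p] (Set.range z) ≤ S) hr
      rintro _ ⟨k, rfl⟩
      have h1 : z k = (z k - w k) + w k := by abel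
      rw [h1]
      exact Submodule.add_mem _ (Submodule.subset_span ⟨Sum.inr k, rfl⟩) (hWS (hw k))
    · rw [LinearMap.smul_apply, LinearMap.id_apply]
      abel
  -- `p b + c = (p - 1) b + (b + c)`, the rank of the kernel of `T` plus that of its image.
  have hcard : Fintype.card ((Fin p × Fin b) ⊕ Fin c) = Module.finrank ℤ_[p] U := by
    simp only [Fintype.card_sum, Fintype.card_prod, Fintype.card_fin]
    rw [← hrank, hWrank, ← hcb]
    obtain ⟨k, hk⟩ : ∃ k, p = k + 1 := ⟨p - 1, (Nat.succ_pred_prime hp.out).symm⟩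
    have h1 : p - 1 = k := by omega
    have h2 : p * b = k * b + b := by
      conv_lhs => rw [hk]
      ring
    rw [h1, h2]
    ring
  let B := basisOfTopLeSpanOfCardEqFinrank F htop.ge hcard
  let φ := Fintype.equivFin ((Fin p × Fin b) ⊕ Fin c)
  refine ⟨_, B.reindex φ, fun i => ?_⟩
  obtain ⟨t, ht⟩ := hF (φ.symm i)
  exact ⟨φ t, by simpa [B] using ht⟩

/-- If the basis `b` is permuted by `ν`, then the kernel of the norm is the image of `ν - 1`. -/
theorem exists_eq_sub_one_of_norm_eq_zero [Module.IsTorsionFree ℤ_[p] U] {ι : Type*}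
    (b : Module.Basis ι ℤ_[p] U) (hb : ∀ i, ∃ j, ν (b i) = b j) {x : U}
    (hx : (∑ j ∈ Finset.range p, ν ^ j) x = 0) : ∃ y, x = (ν - 1) y := by
  let D := LinearMap.range (ν - 1)
  -- On the free module over these classes `ν` acts trivially, so the norm becomes multiplication by
  -- `p`; `s` is a section showing that the kernel of `L` lies in `D`.
  let r : Setoid ι := ⟨fun i j => b i - b j ∈ D, fun i => by simp,
    fun {i j} h => by simpa using D.neg_mem h, fun {i j k} h h' => by simpa using D.add_mem h h'⟩
  let L : U →ₗ[ℤ_[p]] (Quotient r →₀ ℤ_[p]) :=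
    b.constr ℤ_[p] fun i => Finsupp.single (Quotient.mk r i) 1
  let s : (Quotient r →₀ ℤ_[p]) →ₗ[ℤ_[p]] U :=
    Finsupp.lsum ℤ_[p] fun o => LinearMap.toSpanSingleton ℤ_[p] U (b o.out)
  have hL : L.comp ν = L := b.ext fun i => by
    obtain ⟨j, hj⟩ := hb i
    have h1 : Quotient.mk r j = Quotient.mk r i := Quotient.sound (by
      change b j - b i ∈ D
      rw [← hj]
      exact ⟨b i, rfl⟩)
    simp [hj, L, h1]
  have hLpow : ∀ (k : ℕ) (x : U), L ((ν ^ k) x) = L x := fun k x => by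
    induction k with
    | zero => rfl
    | succ k ih => rw [pow_succ', Module.End.mul_apply, ← LinearMap.comp_apply, hL, ih]
  have hs : ∀ x : U, D.mkQ (s (L x)) = D.mkQ x := fun x => by
    have : (D.mkQ.comp s).comp L = D.mkQ := b.ext fun i => by
      simp only [LinearMap.comp_apply, L, Module.Basis.constr_basis]
      simp only [s, Finsupp.lsum_single, LinearMap.toSpanSingleton_apply, one_smul,
        Submodule.mkQ_apply]
      rw [Submodule.Quotient.eq]
      exact Quotient.mk_out (s := r) i
    exact congrArg (fun f => f x) this
  have h1 : (p : ℤ_[p]) • L x = 0 := by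
    have := congrArg L hx
    simp only [LinearMap.sum_apply, map_sum, hLpow, Finset.sum_const, Finset.card_range,
      map_zero] at this
    rwa [Nat.cast_smul_eq_nsmul]
  have h2 : L x = 0 := (smul_eq_zero.1 h1).resolve_left (by exact_mod_cast hp.out.ne_zero)
  have h3 := hs x
  rw [h2, map_zero, map_zero, eq_comm, Submodule.mkQ_apply, Submodule.Quotient.mk_eq_zero] at h3
  obtain ⟨y, hy⟩ := h3
  exact ⟨y, hy.symm⟩

end Permutation

open scoped TensorProduct MonoidAlgebra AlgebraMonoidAlgebra

/-! ### Generators of `N` and of its augmentation ideal. -/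

variable {G : Type*} [CommGroup G]

theorem exists_generator {N : Subgroup G} (hN : Nat.card N = p) :
    ∃ n : G, orderOf n = p ∧ N = Subgroup.zpowers n ∧ ∀ g ∈ N, ∃ k : ℕ, g = n ^ k := by
  have := isCyclic_of_prime_card hN
  obtain ⟨n, hn⟩ := IsCyclic.exists_generator (α := N)
  have hord : orderOf n = p := by rw [orderOf_eq_card_of_forall_mem_zpowers hn, hN]
  have hfin : IsOfFinOrder n := orderOf_pos_iff.1 (hord ▸ hp.out.pos)
  have h1 : ∀ g ∈ N, ∃ k : ℕ, g = (n : G) ^ k := fun g hg => by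
    obtain ⟨k, hk⟩ := (hfin.mem_powers_iff_mem_zpowers).2 (hn ⟨g, hg⟩)
    exact ⟨k, by simpa using (congrArg Subtype.val hk).symm⟩
  refine ⟨n, by rw [Subgroup.orderOf_coe, hord], le_antisymm (fun g hg => ?_) ?_, h1⟩
  · obtain ⟨k, rfl⟩ := h1 g hg
    exact Subgroup.npow_mem_zpowers _ _
  · rw [Subgroup.zpowers_le]
    exact n.2

theorem of_sub_one_dvd {R : Type*} [CommRing R] (n : G) (k : ℕ) :
    MonoidAlgebra.of R G n - 1 ∣ MonoidAlgebra.of R G (n ^ k) - 1 := by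
  rw [map_pow]
  exact sub_one_dvd_pow_sub_one _ _

/-- Each `n ^ k - 1` is a multiple of `n - 1`, so by linearity every `r` differs from its
augmentation by such a multiple. -/
theorem augIdeal_eq_span {N : Subgroup G} {n : G} (hn : n ∈ N)
    (hgen : ∀ g ∈ N, ∃ k : ℕ, g = n ^ k) :
    augIdeal p N = Ideal.span {MonoidAlgebra.of ℤ_[p] G n - 1} := by
  have haug : ∀ g : N, augmentation p N (MonoidAlgebra.of ℤ_[p] N g) = 1 := fun g => by
    simp [augmentation]
  have hmap : ∀ g : N, MonoidAlgebra.mapDomainRingHom ℤ_[p] N.subtype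
      (MonoidAlgebra.of ℤ_[p] N g) = MonoidAlgebra.of ℤ_[p] G g := fun g => by
    simp
  apply le_antisymm
  · rw [augIdeal, Ideal.map_le_iff_le_comap]
    have key : ∀ r : ℤ_[p][N], MonoidAlgebra.mapDomainRingHom ℤ_[p] N.subtype
        (r - algebraMap _ _ (augmentation p N r)) ∈
          Ideal.span {MonoidAlgebra.of ℤ_[p] G n - 1} := fun r => by
      induction r using MonoidAlgebra.induction_on with
      | of g =>
        obtain ⟨k, hk⟩ := hgen g g.2
        rw [haug, map_one, map_sub, map_one, hmap, hk, Ideal.mem_span_singleton]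
        exact of_sub_one_dvd n k
      | add a b ha hb =>
        rw [map_add, map_add, add_sub_add_comm, map_add]
        exact Ideal.add_mem _ ha hb
      | smul c r hr =>
        rw [map_smul, smul_eq_mul, map_mul, Algebra.smul_def, ← mul_sub, map_mul]
        exact Ideal.mul_mem_left _ _ hr
    intro r hr
    have h1 := key r
    rw [RingHom.mem_ker] at hr
    have h2 : augmentation p N r = 0 := hr
    rwa [h2, map_zero, sub_zero] at h1
  · rw [Ideal.span_singleton_le_iff_mem]
    have h1 : MonoidAlgebra.of ℤ_[p] N ⟨n, hn⟩ - 1 ∈ RingHom.ker (augmentation p N) := by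
      rw [RingHom.mem_ker, map_sub, haug, map_one, sub_self]
    have h2 := Ideal.mem_map_of_mem (MonoidAlgebra.mapDomainRingHom ℤ_[p] N.subtype) h1
    rwa [map_sub, map_one, hmap] at h2

theorem mem_augIdeal_smul {N : Subgroup G} {n : G} (hn : n ∈ N)
    (hgen : ∀ g ∈ N, ∃ k : ℕ, g = n ^ k) {M : Type*} [AddCommGroup M] [Module ℤ_[p][G] M]
    (S : Submodule ℤ_[p][G] M) (x : M) :
    x ∈ augIdeal p N • S ↔ ∃ y ∈ S, x = (MonoidAlgebra.of ℤ_[p] G n - 1) • y := by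
  rw [augIdeal_eq_span hn hgen, Submodule.ideal_span_singleton_smul,
    Submodule.mem_smul_pointwise_iff_exists]
  simp only [eq_comm]

/-! ### Reduction of the first equivalence to the norm kernel. -/

section Lattice

variable {U : Type*} [AddCommGroup U] [Module ℤ_[p] U] [Module ℤ_[p][G] U]
  [IsScalarTower ℤ_[p] ℤ_[p][G] U]

variable (p U) in
/-- Every element of `U` killed by the norm `1 + n + ⋯ + n ^ (p - 1)` is a multiple
of `n - 1`. -/
def NormKernelTrivial (n : G) : Prop :=
  ∀ x : U, (∑ j ∈ Finset.range p, MonoidAlgebra.of ℤ_[p] G n ^ j) • x = 0 →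
    ∃ y : U, x = (MonoidAlgebra.of ℤ_[p] G n - 1) • y

theorem norm_mul_of_sub_one {R : Type*} [CommRing R] {m : ℕ} {n : G} (hn : n ^ m = 1) :
    (∑ j ∈ Finset.range m, MonoidAlgebra.of R G n ^ j) * (MonoidAlgebra.of R G n - 1) = 0 := by
  rw [geom_sum_mul, ← map_pow, hn, map_one, sub_self]

theorem isLattice_coinvariants_iff (hU : IsLattice p U) {N : Subgroup G} {n : G} (hn : n ∈ N)
    (hnp : n ^ p = 1) (hgen : ∀ g ∈ N, ∃ k : ℕ, g = n ^ k) :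
    IsLattice p (Coinvariants p N U) ↔ NormKernelTrivial p U n := by
  have := hU.finite
  have := hU.free
  constructor
  · rintro ⟨-, hfree⟩ x hx
    suffices h : x ∈ augIdeal p N • (⊤ : Submodule ℤ_[p][G] U) by
      obtain ⟨y, -, hy⟩ := (mem_augIdeal_smul hn hgen _ _).1 h
      exact ⟨y, hy⟩
    rw [← Submodule.Quotient.mk_eq_zero]
    have h1 : (p : ℤ_[p]) • (Submodule.Quotient.mk x : Coinvariants p N U) = 0 := by
      rw [← Submodule.Quotient.mk_smul, Submodule.Quotient.mk_eq_zero, mem_augIdeal_smul hn hgen]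
      -- The norm is `p` modulo `n - 1`, so a vector killed by the norm gives a `p`-torsion
      -- coinvariant.
      have h2 : MonoidAlgebra.of ℤ_[p] G n - 1 ∣
          (p : ℤ_[p][G]) - ∑ j ∈ Finset.range p, MonoidAlgebra.of ℤ_[p] G n ^ j := by
        have h3 : (p : ℤ_[p][G]) = ∑ j ∈ Finset.range p, 1 := by simp
        rw [h3, ← Finset.sum_sub_distrib]
        exact Finset.dvd_sum fun j _ => (dvd_sub_comm).1 (sub_one_dvd_pow_sub_one _ _)
      obtain ⟨r, hr⟩ := h2
      refine ⟨r • x, trivial, ?_⟩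
      rw [← mul_smul, ← hr, sub_smul, hx, sub_zero, Nat.cast_smul_eq_nsmul,
        Nat.cast_smul_eq_nsmul]
    exact (smul_eq_zero.1 h1).resolve_left (by exact_mod_cast hp.out.ne_zero)
  · intro h
    have hfin : Module.Finite ℤ_[p] (Coinvariants p N U) :=
      Module.Finite.quotient ℤ_[p] _
    have : Module.IsTorsionFree ℤ_[p] (Coinvariants p N U) := by
      refine Module.IsTorsionFree.of_smul_eq_zero fun c x hcx => ?_
      by_contra hne
      obtain ⟨hc, hx⟩ := not_or.1 hne
      obtain ⟨u, rfl⟩ := Submodule.Quotient.mk_surjective _ x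
      rw [← Submodule.Quotient.mk_smul, Submodule.Quotient.mk_eq_zero,
        mem_augIdeal_smul hn hgen] at hcx
      obtain ⟨y, -, hy⟩ := hcx
      apply hx
      rw [Submodule.Quotient.mk_eq_zero, mem_augIdeal_smul hn hgen]
      obtain ⟨v, hv⟩ := h u (by
        have h1 : c • ((∑ j ∈ Finset.range p, MonoidAlgebra.of ℤ_[p] G n ^ j) • u) = 0 := by
          rw [smul_comm, hy, ← mul_smul, norm_mul_of_sub_one hnp, zero_smul]
        exact (smul_eq_zero.1 h1).resolve_left hc)
      exact ⟨v, trivial, hv⟩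
    exact ⟨hfin, Module.free_of_finite_type_torsion_free'⟩

theorem isPermutationRestrictedTo_iff (hU : IsLattice p U) {N : Subgroup G} {n : G} (hn : n ∈ N)
    (hnp : n ^ p = 1) (hgen : ∀ g ∈ N, ∃ k : ℕ, g = n ^ k) :
    IsPermutationRestrictedTo p U N ↔ NormKernelTrivial p U n := by
  have := hU.finite
  have := hU.free
  let ν : Module.End ℤ_[p] U := Algebra.lsmul ℤ_[p] ℤ_[p] U (MonoidAlgebra.of ℤ_[p] G n)
  have hνp : ν ^ p = 1 := by
    rw [← map_pow, ← map_pow, hnp, map_one, map_one]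
  have hT : ∀ x, (∑ j ∈ Finset.range p, ν ^ j) x =
      (∑ j ∈ Finset.range p, MonoidAlgebra.of ℤ_[p] G n ^ j) • x := fun x => by
    simp only [ν, ← map_pow, ← map_sum]
    rfl
  have hd : ∀ x, (ν - 1) x = (MonoidAlgebra.of ℤ_[p] G n - 1) • x := fun x => by
    rw [sub_smul, one_smul]
    rfl
  constructor
  · rintro ⟨d, b, hb⟩ x hx
    rw [← hT] at hx
    obtain ⟨y, hy⟩ := exists_eq_sub_one_of_norm_eq_zero b (fun i => hb n hn i) hx
    exact ⟨y, by rw [hy, hd]⟩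
  · intro h
    obtain ⟨d, b, hb⟩ := exists_basis_permuted hνp fun x hx => by
      rw [hT] at hx
      obtain ⟨y, hy⟩ := h x hx
      exact ⟨y, by rw [hd, hy]⟩
    refine ⟨d, b, fun g hg => ?_⟩
    obtain ⟨k, rfl⟩ := hgen g hg
    clear hg
    induction k with
    | zero => exact fun i => ⟨i, by rw [pow_zero, map_one, one_smul]⟩
    | succ k ih =>
      intro i
      obtain ⟨j, hj⟩ := ih i
      obtain ⟨l, hl⟩ := hb j
      exact ⟨l, by rw [pow_succ', map_mul, mul_smul, hj, ← hl]; rfl⟩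

end Lattice

/-! ### Subgroup sums in the rational group algebra. -/

section GroupAlgebra

variable [Finite G]

omit [Finite G] in
theorem hat_eq_sum (H : Subgroup G) [Fintype H] :
    hat p H = ∑ h : H, MonoidAlgebra.of ℚ_[p] G (h : G) :=
  finsum_eq_sum_of_fintype _

theorem coeff_hat (H : Subgroup G) (g : G) [Decidable (g ∈ H)] :
    (hat p H).coeff g = if g ∈ H then 1 else 0 := by
  classical
  have := Fintype.ofFinite H
  rw [hat_eq_sum, MonoidAlgebra.coeff_sum, Finsupp.finsetSum_apply]
  simp only [MonoidAlgebra.of_apply, MonoidAlgebra.coeff_single, Finsupp.single_apply]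
  split_ifs with h
  · rw [Finset.sum_eq_single ⟨g, h⟩]
    · simp
    · intro b _ hb
      exact if_neg fun h' => hb (Subtype.ext h')
    · simp
  · exact Finset.sum_eq_zero fun b _ => if_neg fun h' : (b : G) = g => h (h' ▸ b.2)

theorem of_mul_hat {H : Subgroup G} {g : G} (hg : g ∈ H) :
    MonoidAlgebra.of ℚ_[p] G g * hat p H = hat p H := by
  have := Fintype.ofFinite H
  rw [hat_eq_sum, Finset.mul_sum]
  refine Fintype.sum_equiv (Equiv.mulLeft (⟨g, hg⟩ : H)) _ _ fun h => ?_
  rw [← map_mul]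
  rfl

theorem hat_mul_hat_of_le {H K : Subgroup G} (hHK : H ≤ K) :
    hat p H * hat p K = (Nat.card H : ℚ_[p][G]) * hat p K := by
  have := Fintype.ofFinite H
  rw [hat_eq_sum H, Finset.sum_mul, Finset.sum_congr rfl fun h _ => of_mul_hat (hHK h.2)]
  simp

theorem hat_mul_hat_of_disjoint {H K : Subgroup G} (h : Disjoint H K)
    (hc : Nat.card H * Nat.card K = Nat.card G) : hat p H * hat p K = hat p ⊤ := by
  have := Fintype.ofFinite H
  have := Fintype.ofFinite K
  have := Fintype.ofFinite (⊤ : Subgroup G)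
  have hb : Function.Bijective fun x : H × K => (x.1 : G) * x.2 :=
    Subgroup.isComplement'_of_card_mul_and_disjoint hc h
  rw [hat_eq_sum H, hat_eq_sum K, hat_eq_sum ⊤, Finset.sum_mul_sum, ← Fintype.sum_prod_type']
  refine Fintype.sum_bijective (fun x : H × K => (⟨x.1 * x.2, trivial⟩ : (⊤ : Subgroup G)))
    ⟨fun x y hxy => hb.1 (congrArg Subtype.val hxy), fun g => ?_⟩ _ _ fun x => ?_
  · obtain ⟨x, hx⟩ := hb.2 g
    exact ⟨x, Subtype.ext hx⟩
  · simp only [map_mul]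

omit [Finite G] in
theorem disjoint_of_card_eq_prime {H K : Subgroup G} (hH : Nat.card H = p) (hK : Nat.card K = p)
    (hne : H ≠ K) : Disjoint H K := by
  have : Finite H := Nat.finite_of_card_ne_zero (hH ▸ hp.out.ne_zero)
  have : Finite K := Nat.finite_of_card_ne_zero (hK ▸ hp.out.ne_zero)
  rw [disjoint_iff]
  have h1 : Nat.card (H ⊓ K : Subgroup G) ∣ p := hH ▸ Subgroup.card_dvd_of_le inf_le_left
  rcases (Nat.dvd_prime hp.out).1 h1 with h | h
  · exact Subgroup.eq_bot_of_card_eq _ h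
  · exact absurd ((Subgroup.eq_of_le_of_card_ge inf_le_left (by rw [h, hH])).symm.trans
      (Subgroup.eq_of_le_of_card_ge inf_le_right (by rw [h, hK]))) hne

theorem hat_mul_hat_of_ne (hG : Nat.card G = p ^ 2) {H K : Subgroup G} (hH : Nat.card H = p)
    (hK : Nat.card K = p) (hne : H ≠ K) : hat p H * hat p K = hat p ⊤ :=
  hat_mul_hat_of_disjoint (disjoint_of_card_eq_prime hH hK hne) (by rw [hH, hK, hG, sq])

theorem hat_mul_self {H : Subgroup G} (hH : Nat.card H = p) :
    hat p H * hat p H = (p : ℚ_[p][G]) * hat p H := by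
  rw [hat_mul_hat_of_le le_rfl, hH]

theorem hat_mul_top {H : Subgroup G} (hH : Nat.card H = p) :
    hat p H * hat p ⊤ = (p : ℚ_[p][G]) * hat p ⊤ := by
  rw [hat_mul_hat_of_le le_top, hH]

theorem top_mul_top (hG : Nat.card G = p ^ 2) :
    hat p (⊤ : Subgroup G) * hat p ⊤ = (p : ℚ_[p][G]) ^ 2 * hat p ⊤ := by
  rw [hat_mul_hat_of_le le_rfl, Subgroup.card_top, hG, Nat.cast_pow]

/-- Every nontrivial element lies in exactly one subgroup of order `p`; only the coefficient at `1`
depends on the number `m` of subgroups. -/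
theorem sum_hat (hG : Nat.card G = p ^ 2) (hexp : ∀ g : G, g ^ p = 1)
    [Fintype {H : Subgroup G // Nat.card H = p}] :
    ∑ H : {H : Subgroup G // Nat.card H = p}, hat p H.1 = (p : ℚ_[p][G]) + hat p ⊤ := by
  classical
  let m : ℚ_[p] := Fintype.card {H : Subgroup G // Nat.card H = p}
  have h1 : ∑ H : {H : Subgroup G // Nat.card H = p}, hat p H.1 =
      (m - 1) • (1 : ℚ_[p][G]) + hat p ⊤ := by
    ext g
    rw [MonoidAlgebra.coeff_sum, Finsupp.finsetSum_apply]
    simp only [coeff_hat, MonoidAlgebra.coeff_add, MonoidAlgebra.coeff_smul, Finsupp.add_apply,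
      Finsupp.smul_apply, MonoidAlgebra.one_def, MonoidAlgebra.coeff_single, Finsupp.single_apply]
    by_cases hg : g = 1
    · subst hg
      simp [m]
    · have hz : Nat.card (Subgroup.zpowers g) = p := by
        rw [Nat.card_zpowers]
        exact orderOf_eq_prime (hexp g) hg
      rw [Finset.sum_eq_single ⟨_, hz⟩]
      · simp [Ne.symm hg]
      · intro K _ hK
        refine if_neg fun h => hK (Subtype.ext ?_)
        exact (Subgroup.eq_of_le_of_card_ge (Subgroup.zpowers_le.2 h)
          (by rw [K.2, hz])).symm
      · simp
  -- Multiplying by the sum over `G` counts the subgroups: `m p = (m - 1) + p ^ 2`, whence `m - 1 =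
  -- p`.
  have h2 := congrArg (fun x => (x * hat p ⊤).coeff 1) h1
  have h4 : (∑ H : {H : Subgroup G // Nat.card H = p}, hat p H.1) * hat p ⊤ =
      ((Fintype.card {H : Subgroup G // Nat.card H = p} * p : ℕ) : ℚ_[p][G]) * hat p ⊤ := by
    rw [Finset.sum_mul, Finset.sum_congr rfl fun H _ => hat_mul_top H.2, Finset.sum_const,
      Finset.card_univ, nsmul_eq_mul, ← mul_assoc, Nat.cast_mul]
  simp only [h4, add_mul, top_mul_top hG, smul_mul_assoc, one_mul] at h2
  simp only [← Nat.cast_pow, ← nsmul_eq_mul, MonoidAlgebra.coeff_add, MonoidAlgebra.coeff_smul,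
    Finsupp.add_apply, Finsupp.smul_apply, coeff_hat, Subgroup.mem_top, if_true] at h2
  simp only [nsmul_eq_mul, smul_eq_mul, mul_one, Nat.cast_pow, Nat.cast_mul] at h2
  have hp1 : (p : ℚ_[p]) - 1 ≠ 0 := by
    rw [sub_ne_zero]
    exact_mod_cast hp.out.one_lt.ne'
  have h3 : m - 1 = p := by
    apply mul_right_cancel₀ hp1
    linear_combination h2
  rw [h1, h3, Algebra.smul_def, mul_one, map_natCast]

end GroupAlgebra

/-! ### The idempotents `e_i`: orthogonality and completeness. -/

section Idempotents

theorem invOf_mul_natCast :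
    algebraMap ℚ_[p] ℚ_[p][G] (p : ℚ_[p])⁻¹ * (p : ℚ_[p][G]) = 1 := by
  rw [← map_natCast (algebraMap ℚ_[p] ℚ_[p][G]), ← map_mul,
    inv_mul_cancel₀ (by exact_mod_cast hp.out.ne_zero), map_one]

theorem idem_none_eq : idem p (none : Idx p G) =
    algebraMap ℚ_[p] ℚ_[p][G] (p : ℚ_[p])⁻¹ ^ 2 * hat p ⊤ := by
  rw [idem, Algebra.smul_def, ← inv_pow, map_pow]

theorem idem_some_eq (H : {H : Subgroup G // Nat.card H = p}) : idem p (some H) =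
    algebraMap ℚ_[p] ℚ_[p][G] (p : ℚ_[p])⁻¹ ^ 2 * ((p : ℚ_[p][G]) * hat p H.1 - hat p ⊤) := by
  rw [idem, Algebra.smul_def, ← inv_pow, map_pow, Algebra.smul_def, map_natCast]

/-- The right side projects onto the `H`-fixed vectors, which therefore have components only at `0`
and `H`. -/
theorem idem_none_add_idem_some (H : {H : Subgroup G // Nat.card H = p}) :
    idem p none + idem p (some H) =
      algebraMap ℚ_[p] ℚ_[p][G] (p : ℚ_[p])⁻¹ * hat p H.1 := by
  rw [idem_none_eq, idem_some_eq]
  linear_combination (algebraMap ℚ_[p] ℚ_[p][G] (p : ℚ_[p])⁻¹ * hat p H.1) *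
    invOf_mul_natCast (p := p) (G := G)

theorem hat_eq_sum_pow {N : Subgroup G} {n : G} (hn : orderOf n = p)
    (hN : N = Subgroup.zpowers n) :
    hat p N = ∑ j ∈ Finset.range p, MonoidAlgebra.of ℚ_[p] G n ^ j := by
  classical
  subst hN
  have hfin : IsOfFinOrder n := orderOf_pos_iff.1 (hn ▸ hp.out.pos)
  have : Finite (Subgroup.zpowers n) := hfin.finite_zpowers
  have := Fintype.ofFinite (Subgroup.zpowers n)
  rw [hat_eq_sum, ← Fin.sum_univ_eq_sum_range]
  refine (Fintype.sum_equiv ((finCongr hn.symm).trans (finEquivZPowers hfin)) _ _ fun j => ?_).symm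
  rw [← map_pow]
  simp [finEquivZPowers_apply]

variable [Finite G]

theorem of_mul_idem_none (g : G) :
    MonoidAlgebra.of ℚ_[p] G g * idem p none = idem p none := by
  rw [idem_none_eq, mul_left_comm, of_mul_hat (Subgroup.mem_top g)]

theorem of_mul_idem_some (H : {H : Subgroup G // Nat.card H = p}) {g : G} (hg : g ∈ H.1) :
    MonoidAlgebra.of ℚ_[p] G g * idem p (some H) = idem p (some H) := by
  rw [idem_some_eq, mul_left_comm, mul_sub, mul_left_comm _ (p : ℚ_[p][G]), of_mul_hat hg,
    of_mul_hat (Subgroup.mem_top g)]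

theorem hat_mul_idem_some_of_ne (hG : Nat.card G = p ^ 2) {N : Subgroup G} (hN : Nat.card N = p)
    (H : {H : Subgroup G // Nat.card H = p}) (hne : H.1 ≠ N) :
    hat p N * idem p (some H) = 0 := by
  rw [idem_some_eq]
  linear_combination (algebraMap ℚ_[p] ℚ_[p][G] (p : ℚ_[p])⁻¹ ^ 2) *
    ((p : ℚ_[p][G]) * hat_mul_hat_of_ne hG hN H.2 hne.symm - hat_mul_top hN)

theorem idem_mul_self (hG : Nat.card G = p ^ 2) (i : Idx p G) :
    idem p i * idem p i = idem p i := by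
  have ha := invOf_mul_natCast (p := p) (G := G)
  set a := algebraMap ℚ_[p] ℚ_[p][G] (p : ℚ_[p])⁻¹
  cases i with
  | none =>
    rw [idem_none_eq]
    linear_combination a ^ 4 * top_mul_top hG + a ^ 2 * hat p ⊤ * (a * p + 1) * ha
  | some H =>
    rw [idem_some_eq]
    linear_combination a ^ 4 * (p : ℚ_[p][G]) ^ 2 * hat_mul_self H.2
      - 2 * a ^ 4 * (p : ℚ_[p][G]) * hat_mul_top H.2 + a ^ 4 * top_mul_top hG
      + a ^ 2 * ((p : ℚ_[p][G]) * hat p H.1 - hat p ⊤) * (a * p + 1) * ha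

theorem idem_mul_of_ne (hG : Nat.card G = p ^ 2) {i j : Idx p G} (hij : i ≠ j) :
    idem p i * idem p j = 0 := by
  set a := algebraMap ℚ_[p] ℚ_[p][G] (p : ℚ_[p])⁻¹ with ha
  rcases i with _ | H <;> rcases j with _ | K
  · exact absurd rfl hij
  · rw [idem_none_eq, idem_some_eq, ← ha]
    linear_combination a ^ 4 * ((p : ℚ_[p][G]) * hat_mul_top K.2 - top_mul_top hG)
  · rw [idem_none_eq, idem_some_eq, ← ha]
    linear_combination a ^ 4 * ((p : ℚ_[p][G]) * hat_mul_top H.2 - top_mul_top hG)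
  · have hne : H.1 ≠ K.1 := fun h => hij (congrArg some (Subtype.ext h))
    rw [idem_some_eq, idem_some_eq, ← ha]
    linear_combination a ^ 4 * ((p : ℚ_[p][G]) ^ 2 * hat_mul_hat_of_ne hG H.2 K.2 hne
      - (p : ℚ_[p][G]) * hat_mul_top H.2 - (p : ℚ_[p][G]) * hat_mul_top K.2 + top_mul_top hG)

theorem sum_idem (hG : Nat.card G = p ^ 2) (hexp : ∀ g : G, g ^ p = 1)
    [Fintype {H : Subgroup G // Nat.card H = p}] : ∑ i : Idx p G, idem p i = 1 := by
  have ha := invOf_mul_natCast (p := p) (G := G)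
  have hs := sum_hat hG hexp
  have hc : (Fintype.card {H : Subgroup G // Nat.card H = p} : ℚ_[p][G]) * hat p ⊤ =
      ((p : ℚ_[p][G]) + 1) * hat p ⊤ := by
    have h1 := congrArg (· * hat p ⊤) hs
    simp only [Finset.sum_mul] at h1
    rw [Finset.sum_congr rfl fun H _ => hat_mul_top H.2, Finset.sum_const, Finset.card_univ,
      nsmul_eq_mul] at h1
    linear_combination algebraMap ℚ_[p] ℚ_[p][G] (p : ℚ_[p])⁻¹ * (h1 + top_mul_top hG) -
      ((Fintype.card {H : Subgroup G // Nat.card H = p} : ℚ_[p][G]) * hat p ⊤ -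
        hat p ⊤ - (p : ℚ_[p][G]) * hat p ⊤) * ha
  rw [Fintype.sum_option, idem_none_eq]
  simp only [idem_some_eq]
  rw [← Finset.mul_sum, Finset.sum_sub_distrib, ← Finset.mul_sum, hs, Finset.sum_const,
    Finset.card_univ, nsmul_eq_mul, hc]
  linear_combination (algebraMap ℚ_[p] ℚ_[p][G] (p : ℚ_[p])⁻¹ * p + 1) * ha

end Idempotents

/-! ### Modules on which `G` acts through powers of `n` and the norm vanishes. -/

section Summand

theorem exists_mul_pow [Finite G] (hG : Nat.card G = p ^ 2) {N H : Subgroup G}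
    (hN : Nat.card N = p) (hH : Nat.card H = p) (hne : H ≠ N) {n : G}
    (hgen : ∀ g ∈ N, ∃ k : ℕ, g = n ^ k) (g : G) : ∃ h ∈ H, ∃ k : ℕ, g = h * n ^ k := by
  have hb : Function.Bijective fun x : H × N => (x.1 : G) * x.2 :=
    Subgroup.isComplement'_of_card_mul_and_disjoint (by rw [hH, hN, hG, sq])
      (disjoint_of_card_eq_prime hH hN hne)
  obtain ⟨⟨h, m⟩, hm⟩ := hb.2 g
  obtain ⟨k, hk⟩ := hgen m m.2
  exact ⟨h, h.2, k, by rw [← hk]; exact hm.symm⟩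

section Cyclic

variable {M : Type*} [AddCommGroup M] [Module ℤ_[p] M] [Module ℤ_[p][G] M]
  [IsScalarTower ℤ_[p] ℤ_[p][G] M] {n : G}

variable (p M) in
/-- Multiplication by `n` as a `ℤ_p`-linear operator. -/
noncomputable def mulOp (n : G) : Module.End ℤ_[p] M :=
  Algebra.lsmul ℤ_[p] ℤ_[p] M (MonoidAlgebra.of ℤ_[p] G n)

theorem mulOp_pow_apply (k : ℕ) (x : M) :
    (mulOp p M n ^ k) x = MonoidAlgebra.of ℤ_[p] G (n ^ k) • x := by
  rw [mulOp, ← map_pow, ← map_pow]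
  rfl

theorem mulOp_sub_one_apply (x : M) :
    (mulOp p M n - 1) x = (MonoidAlgebra.of ℤ_[p] G n - 1) • x := by
  rw [sub_smul, one_smul]
  rfl

theorem sum_mulOp_pow_eq_zero
    (hn : ∀ x : M, (∑ j ∈ Finset.range p, MonoidAlgebra.of ℤ_[p] G n ^ j) • x = 0) :
    ∑ j ∈ Finset.range p, mulOp p M n ^ j = 0 := by
  ext x
  rw [LinearMap.zero_apply, ← hn x, mulOp]
  simp only [← map_pow, ← map_sum]
  rfl

/-- When `G` acts through the powers of `n`, a `ℤ_p`-submodule stable under `n` is a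
`ℤ_p G`-submodule. -/
noncomputable def stableSubmodule
    (hact : ∀ g : G, ∃ k : ℕ, ∀ x : M,
      MonoidAlgebra.of ℤ_[p] G g • x = MonoidAlgebra.of ℤ_[p] G (n ^ k) • x)
    (S : Submodule ℤ_[p] M) (hS : ∀ x ∈ S, mulOp p M n x ∈ S) : Submodule ℤ_[p][G] M where
  __ := S
  smul_mem' r x hx := by
    change x ∈ S at hx
    change r • x ∈ S
    induction r using MonoidAlgebra.induction_on with
    | of g =>
      obtain ⟨k, hk⟩ := hact g
      rw [hk, ← mulOp_pow_apply]
      exact pow_map_mem _ hS hx k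
    | add a b ha hb => rw [add_smul]; exact S.add_mem ha hb
    | smul c r hr => rw [smul_assoc]; exact S.smul_mem c hr

theorem mem_stableSubmodule
    {hact : ∀ g : G, ∃ k : ℕ, ∀ x : M,
      MonoidAlgebra.of ℤ_[p] G g • x = MonoidAlgebra.of ℤ_[p] G (n ^ k) • x}
    {S : Submodule ℤ_[p] M} {hS : ∀ x ∈ S, mulOp p M n x ∈ S} {x : M} :
    x ∈ stableSubmodule hact S hS ↔ x ∈ S := Iff.rfl

theorem orbitSpan_le_span {ι : Type*} (v : ι → M) {x : M}
    (hx : x ∈ orbitSpan (mulOp p M n) v) : x ∈ Submodule.span ℤ_[p][G] (Set.range v) := by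
  refine (Submodule.span_le.2 ?_ : orbitSpan (mulOp p M n) v ≤
    (Submodule.span ℤ_[p][G] (Set.range v)).restrictScalars ℤ_[p]) hx
  rintro _ ⟨⟨j, i⟩, rfl⟩
  change (mulOp p M n ^ (j : ℕ)) (v i) ∈ Submodule.span ℤ_[p][G] (Set.range v)
  rw [mulOp_pow_apply]
  exact Submodule.smul_mem _ _ (Submodule.subset_span ⟨i, rfl⟩)

theorem stableSubmodule_orbitSpan
    (hact : ∀ g : G, ∃ k : ℕ, ∀ x : M,
      MonoidAlgebra.of ℤ_[p] G g • x = MonoidAlgebra.of ℤ_[p] G (n ^ k) • x)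
    (hn : ∀ x : M, (∑ j ∈ Finset.range p, MonoidAlgebra.of ℤ_[p] G n ^ j) • x = 0) (x : M) :
    stableSubmodule hact (orbitSpan (mulOp p M n) fun _ : Unit => x)
      (map_mem_orbitSpan (sum_mulOp_pow_eq_zero hn) _) = Submodule.span ℤ_[p][G] {x} := by
  apply le_antisymm
  · intro y hy
    have h := orbitSpan_le_span _ (mem_stableSubmodule.1 hy)
    rwa [Set.range_const] at h
  · rw [Submodule.span_singleton_le_iff_mem, mem_stableSubmodule]
    exact mem_orbitSpan (fun _ : Unit => x) ()

/-- The `ℤ_p`-span of the first `p - 1` translates of the generator is already `G`-stable. -/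
theorem finite_and_finrank_le_of_cyclic
    (hact : ∀ g : G, ∃ k : ℕ, ∀ x : M,
      MonoidAlgebra.of ℤ_[p] G g • x = MonoidAlgebra.of ℤ_[p] G (n ^ k) • x)
    (hn : ∀ x : M, (∑ j ∈ Finset.range p, MonoidAlgebra.of ℤ_[p] G n ^ j) • x = 0) (x : M)
    (hx : Submodule.span ℤ_[p][G] {x} = ⊤) :
    Module.Finite ℤ_[p] M ∧ Module.finrank ℤ_[p] M ≤ p - 1 := by
  have h1 : orbitSpan (mulOp p M n) (fun _ : Unit => x) = ⊤ := by
    rw [eq_top_iff]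
    intro y _
    have hy : y ∈ Submodule.span ℤ_[p][G] {x} := hx ▸ Submodule.mem_top
    rw [← stableSubmodule_orbitSpan hact hn] at hy
    exact mem_stableSubmodule.1 hy
  constructor
  · refine ⟨?_⟩
    rw [← h1]
    exact Submodule.fg_span (Set.finite_range _)
  · have := finrank_orbitSpan_le (ν := mulOp p M n) fun _ : Unit => x
    rw [h1, finrank_top] at this
    simpa using this

theorem exists_isCompl_span [Module.Finite ℤ_[p] M] [Module.Free ℤ_[p] M]
    (hact : ∀ g : G, ∃ k : ℕ, ∀ x : M,
      MonoidAlgebra.of ℤ_[p] G g • x = MonoidAlgebra.of ℤ_[p] G (n ^ k) • x)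
    (hn : ∀ x : M, (∑ j ∈ Finset.range p, MonoidAlgebra.of ℤ_[p] G n ^ j) • x = 0) {x : M}
    (hx : ∀ y, x ≠ (MonoidAlgebra.of ℤ_[p] G n - 1) • y) :
    ∃ C : Submodule ℤ_[p][G] M, IsCompl (Submodule.span ℤ_[p][G] {x}) C ∧
      Module.finrank ℤ_[p] (Submodule.span ℤ_[p][G] {x}) = p - 1 := by
  have hν := sum_mulOp_pow_eq_zero hn
  obtain ⟨C, hC, hcompl, hrank⟩ := exists_isCompl_orbitSpan hν
    (u := x) fun ⟨y, hy⟩ => hx y (by rw [← hy, mulOp_sub_one_apply])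
  refine ⟨stableSubmodule hact C hC, ?_, ?_⟩
  · rw [← stableSubmodule_orbitSpan hact hn]
    constructor
    · rw [Submodule.disjoint_def]
      exact fun y ha hc => Submodule.disjoint_def.1 hcompl.disjoint y
        (mem_stableSubmodule.1 ha) (mem_stableSubmodule.1 hc)
    · rw [codisjoint_iff, eq_top_iff]
      intro y _
      have hy : y ∈ orbitSpan (mulOp p M n) (fun _ : Unit => x) ⊔ C :=
        hcompl.sup_eq_top ▸ Submodule.mem_top
      obtain ⟨a, ha, c, hc, rfl⟩ := Submodule.mem_sup.1 hy
      exact Submodule.add_mem_sup (mem_stableSubmodule.2 ha) (mem_stableSubmodule.2 hc)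
  · rw [← stableSubmodule_orbitSpan hact hn]
    exact hrank

end Cyclic

end Summand

/-! ### The components `e_H U` and summands isomorphic to `Λ_(H)`. -/

section RationalModule

variable {Q : Type*} [AddCommGroup Q] [Module ℚ_[p][G] Q] [Module ℤ_[p][G] Q]
  [IsScalarTower ℤ_[p][G] ℚ_[p][G] Q]

theorem algebraMap_of (g : G) :
    algebraMap ℤ_[p][G] ℚ_[p][G] (MonoidAlgebra.of ℤ_[p] G g) = MonoidAlgebra.of ℚ_[p] G g := by
  rw [MonoidAlgebra.algebraMap_def, MonoidAlgebra.of_apply, MonoidAlgebra.mapRingHom_single,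
    map_one, MonoidAlgebra.of_apply]

theorem of_smul_eq (g : G) (x : Q) :
    MonoidAlgebra.of ℤ_[p] G g • x = MonoidAlgebra.of ℚ_[p] G g • x := by
  rw [← algebraMap_of, algebraMap_smul]

theorem sum_pow_smul_eq_hat_smul {N : Subgroup G} {n : G} (hn : orderOf n = p)
    (hN : N = Subgroup.zpowers n) (x : Q) :
    (∑ j ∈ Finset.range p, MonoidAlgebra.of ℤ_[p] G n ^ j) • x = hat p N • x := by
  rw [hat_eq_sum_pow hn hN, ← algebraMap_smul ℚ_[p][G], map_sum]
  simp only [map_pow, algebraMap_of]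

section Component

variable [Finite G] (hG : Nat.card G = p ^ 2) {N : Subgroup G} (hN : Nat.card N = p)
  {n : G} (hgen : ∀ g ∈ N, ∃ k : ℕ, g = n ^ k) (H : {H : Subgroup G // Nat.card H = p})
  (hne : H.1 ≠ N)
include hG hN hne

-- `G = H N` and `H` acts trivially on the `e_H`-component; `k` depends on `g` only.
include hgen in
theorem exists_of_smul_eq_of_pow_smul (g : G) : ∃ k : ℕ, ∀ x : Q, idem p (some H) • x = x →
    MonoidAlgebra.of ℤ_[p] G g • x = MonoidAlgebra.of ℤ_[p] G (n ^ k) • x := by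
  obtain ⟨h, hh, k, rfl⟩ := exists_mul_pow hG hN H.2 hne hgen g
  refine ⟨k, fun x hx => ?_⟩
  rw [mul_comm, map_mul, mul_smul]
  congr 1
  rw [of_smul_eq, ← hx, ← mul_smul, of_mul_idem_some H hh]

omit [Module ℤ_[p][G] Q] [IsScalarTower ℤ_[p][G] ℚ_[p][G] Q] in
theorem hat_smul_eq_zero {x : Q} (hx : idem p (some H) • x = x) : hat p N • x = 0 := by
  rw [← hx, ← mul_smul, hat_mul_idem_some_of_ne hG hN H hne, zero_smul]

end Component

theorem finite_and_finrank_Lam_le [Finite G] (hG : Nat.card G = p ^ 2) {N : Subgroup G}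
    (hN : Nat.card N = p) {n : G} (hord : orderOf n = p) (hNn : N = Subgroup.zpowers n)
    (hgen : ∀ g ∈ N, ∃ k : ℕ, g = n ^ k) (H : {H : Subgroup G // Nat.card H = p})
    (hne : H.1 ≠ N) :
    Module.Finite ℤ_[p] (Lam p (some H)) ∧ Module.finrank ℤ_[p] (Lam p (some H)) ≤ p - 1 := by
  have hfix : ∀ x : Lam p (some H), idem p (some H) • (x : ℚ_[p][G]) = x := fun x => by
    obtain ⟨r, hr⟩ := Submodule.mem_span_singleton.1 x.2
    rw [← hr, smul_comm, smul_eq_mul, idem_mul_self hG]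
  refine finite_and_finrank_le_of_cyclic (n := n) (fun g => ?_) (fun x => ?_)
    ⟨idem p (some H), Submodule.mem_span_singleton_self _⟩ ?_
  · obtain ⟨k, hk⟩ := exists_of_smul_eq_of_pow_smul (Q := ℚ_[p][G]) hG hN hgen H hne g
    exact ⟨k, fun x => Subtype.ext (hk x (hfix x))⟩
  · apply Subtype.ext
    rw [Submodule.coe_smul, sum_pow_smul_eq_hat_smul hord hNn,
      hat_smul_eq_zero hG hN H hne (hfix x), Submodule.coe_zero]
  · rw [eq_top_iff]
    rintro ⟨x, hx⟩ -
    obtain ⟨r, rfl⟩ := Submodule.mem_span_singleton.1 hx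
    exact Submodule.mem_span_singleton.2 ⟨r, rfl⟩

/-- An element of `U` lying in `e_H U` but not in `(n - 1) e_H U` generates a direct summand
of `U` isomorphic to `Λ_(H)`. -/
theorem exists_isCompl_equiv_Lam [SMulCommClass ℚ_[p][G] ℤ_[p][G] Q] [Module ℤ_[p] Q]
    [IsScalarTower ℤ_[p] ℤ_[p][G] Q] [Module.IsTorsionFree ℤ_[p] Q]
    {U : Type*} [AddCommGroup U] [Module ℤ_[p] U] [Module ℤ_[p][G] U]
    [IsScalarTower ℤ_[p] ℤ_[p][G] U] [Module.Finite ℤ_[p] U]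
    [Finite G] (hG : Nat.card G = p ^ 2) {N : Subgroup G}
    (hN : Nat.card N = p) {n : G} (hord : orderOf n = p) (hNn : N = Subgroup.zpowers n)
    (hgen : ∀ g ∈ N, ∃ k : ℕ, g = n ^ k) (H : {H : Subgroup G // Nat.card H = p})
    (hne : H.1 ≠ N) (ι : U →ₗ[ℤ_[p][G]] Q) (hι : Function.Injective ι) {u : U}
    (hu : idem p (some H) • ι u = ι u)
    (hnot : ∀ v : U, ι u ≠ (MonoidAlgebra.of ℤ_[p] G n - 1) • idem p (some H) • ι v) :
    ∃ W W' : Submodule ℤ_[p][G] U, IsCompl W W' ∧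
      Nonempty (W ≃ₗ[ℤ_[p][G]] Lam p (some H)) := by
  let π₀ : U →ₗ[ℤ_[p][G]] Q := (DistribSMul.toLinearMap ℤ_[p][G] Q (idem p (some H))).comp ι
  have hπ₀ : ∀ v, π₀ v = idem p (some H) • ι v := fun _ => rfl
  let M : Submodule ℤ_[p][G] Q := LinearMap.range π₀
  let π : U →ₗ[ℤ_[p][G]] M := π₀.rangeRestrict
  have hπ : Function.Surjective π := π₀.surjective_rangeRestrict
  have hfix : ∀ x : M, idem p (some H) • (x : Q) = x := fun x => by
    obtain ⟨v, hv⟩ := x.2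
    rw [← hv, hπ₀, ← mul_smul, idem_mul_self hG]
  have : Module.Finite ℤ_[p] M :=
    Module.Finite.of_surjective (π.restrictScalars ℤ_[p]) hπ
  have : Module.IsTorsionFree ℤ_[p] M :=
    Function.Injective.moduleIsTorsionFree (M.subtype) M.subtype_injective fun _ _ => rfl
  have : Module.Free ℤ_[p] M := Module.free_of_finite_type_torsion_free'
  have hπu : (π u : Q) = ι u := hu
  obtain ⟨C, hC, hrank⟩ := exists_isCompl_span (p := p) (M := M) (n := n) (x := π u) (fun g => by
      obtain ⟨k, hk⟩ := exists_of_smul_eq_of_pow_smul (Q := Q) hG hN hgen H hne g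
      exact ⟨k, fun x => Subtype.ext (hk x (hfix x))⟩)
    (fun x => Subtype.ext (by
      rw [Submodule.coe_smul, sum_pow_smul_eq_hat_smul hord hNn,
        hat_smul_eq_zero hG hN H hne (hfix x), Submodule.coe_zero]))
    (fun y hy => by
      obtain ⟨v, rfl⟩ := hπ y
      exact hnot v (by rw [← hπu, hy]; rfl))
  -- As `e_H` fixes `u`, the projection `π` is injective on the submodule generated by `u`, so a
  -- complement in `e_H U` pulls back to one in `U`.
  have hker : ∀ r : ℤ_[p][G], π (r • u) = 0 → r • u = 0 := fun r hr => by
    apply hι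
    rw [map_zero, map_smul, ← hπu, ← Submodule.coe_smul, ← map_smul, hr, Submodule.coe_zero]
  refine ⟨Submodule.span _ {u}, C.comap π, ⟨?_, ?_⟩, ?_⟩
  · rw [Submodule.disjoint_def]
    intro x hx hxC
    obtain ⟨r, rfl⟩ := Submodule.mem_span_singleton.1 hx
    refine hker r (Submodule.disjoint_def.1 hC.disjoint _ ?_ hxC)
    rw [map_smul]
    exact Submodule.smul_mem _ _ (Submodule.mem_span_singleton_self _)
  · rw [codisjoint_iff, eq_top_iff]
    intro x _
    have hx : π x ∈ Submodule.span ℤ_[p][G] {π u} ⊔ C := hC.sup_eq_top ▸ Submodule.mem_top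
    obtain ⟨a, ha, c, hc, hac⟩ := Submodule.mem_sup.1 hx
    obtain ⟨r, rfl⟩ := Submodule.mem_span_singleton.1 ha
    have h1 : x = r • u + (x - r • u) := by abel
    rw [h1]
    refine Submodule.add_mem_sup (Submodule.smul_mem _ _ (Submodule.mem_span_singleton_self _)) ?_
    rw [Submodule.mem_comap, map_sub, map_smul, ← hac, add_sub_cancel_left]
    exact hc
  · obtain ⟨hfin, hle⟩ := finite_and_finrank_Lam_le hG hN hord hNn hgen H hne
    have : Module.IsTorsionFree ℤ_[p] (Lam p (some H)) :=
      Function.Injective.moduleIsTorsionFree (Submodule.subtype _)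
        (Submodule.subtype_injective _) fun _ _ => rfl
    let φ₀ : Lam p (some H) →ₗ[ℤ_[p][G]] Q :=
      { toFun := fun y => (y : ℚ_[p][G]) • ι u
        map_add' := fun y z => add_smul _ _ _
        map_smul' := fun r y => smul_assoc _ _ _ }
    have hφ₀ : ∀ (r : ℤ_[p][G]) (y : Lam p (some H)), r • idem p (some H) = (y : ℚ_[p][G]) →
        φ₀ y = r • (π u : M) := fun r y hr => by
      change (y : ℚ_[p][G]) • ι u = _
      rw [← hr, smul_assoc, hu, hπu]
    let P : Submodule ℤ_[p][G] M := Submodule.span _ {π u}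
    let φ₁ : Lam p (some H) →ₗ[ℤ_[p][G]] M := φ₀.codRestrict M fun y => by
      obtain ⟨r, hr⟩ := Submodule.mem_span_singleton.1 y.2
      rw [hφ₀ r y hr]
      exact (r • π u).2
    have hφ₁ : ∀ (r : ℤ_[p][G]) (y : Lam p (some H)), r • idem p (some H) = (y : ℚ_[p][G]) →
        φ₁ y = r • π u := fun r y hr => Subtype.ext (hφ₀ r y hr)
    let φ : Lam p (some H) →ₗ[ℤ_[p][G]] P := φ₁.codRestrict P fun y => by
      obtain ⟨r, hr⟩ := Submodule.mem_span_singleton.1 y.2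
      exact Submodule.mem_span_singleton.2 ⟨r, (hφ₁ r y hr).symm⟩
    have hφ : Function.Surjective φ := by
      rintro ⟨x, hx⟩
      obtain ⟨r, rfl⟩ := Submodule.mem_span_singleton.1 hx
      exact ⟨⟨r • idem p (some H), Submodule.smul_mem _ _ (Submodule.mem_span_singleton_self _)⟩,
        Subtype.ext (hφ₁ r _ rfl)⟩
    -- `Λ_(H)` surjects onto `P`, has rank at most `p - 1`, and `P` has rank exactly `p - 1`.
    have hφinj : Function.Injective φ :=
      injective_of_surjective_of_finrank_le (p := p) (L := Lam p (some H)) (M := P)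
        (φ.restrictScalars ℤ_[p]) hφ (hle.trans hrank.ge)
    let W : Submodule ℤ_[p][G] U := Submodule.span _ {u}
    let ψ : W →ₗ[ℤ_[p][G]] P := π.restrict fun x hx => by
      obtain ⟨r, rfl⟩ := Submodule.mem_span_singleton.1 hx
      exact Submodule.mem_span_singleton.2 ⟨r, (map_smul π r u).symm⟩
    have hψ : Function.Bijective ψ := by
      constructor
      · refine (injective_iff_map_eq_zero ψ).2 ?_
        rintro ⟨x, hx⟩ h0
        obtain ⟨r, rfl⟩ := Submodule.mem_span_singleton.1 hx
        exact Subtype.ext (hker r (congrArg Subtype.val h0))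
      · rintro ⟨x, hx⟩
        obtain ⟨r, rfl⟩ := Submodule.mem_span_singleton.1 hx
        exact ⟨⟨r • u, Submodule.smul_mem _ _ (Submodule.mem_span_singleton_self _)⟩,
          Subtype.ext (map_smul π r u)⟩
    exact ⟨(LinearEquiv.ofBijective ψ hψ).trans (LinearEquiv.ofBijective φ ⟨hφinj, hφ⟩).symm⟩

end RationalModule

/-! ### The diagram of `U` and the two containments. -/

section Diagram

variable {U : Type*} [AddCommGroup U] [Module ℤ_[p] U] [Module ℤ_[p][G] U]
  [IsScalarTower ℤ_[p] ℤ_[p][G] U]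

theorem toRatSpan_injective (hU : IsLattice p U) : Function.Injective (toRatSpan p G U) := by
  have := hU.free
  have h1 : Function.Injective (Algebra.linearMap ℤ_[p] ℚ_[p]) := IsFractionRing.injective _ _
  have h2 := Module.Flat.rTensor_preserves_injective_linearMap (M := U) _ h1
  intro u v huv
  have h3 : (1 : ℤ_[p]) ⊗ₜ[ℤ_[p]] u = 1 ⊗ₜ[ℤ_[p]] v := by
    apply h2
    rw [LinearMap.rTensor_tmul, LinearMap.rTensor_tmul, Algebra.linearMap_apply, map_one]
    exact huv
  simpa using congrArg (TensorProduct.lid ℤ_[p] U) h3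

variable (p G U) in
/-- `ℚ_p U` as a `ℤ_p`-module, by restriction of scalars from `ℤ_p G`. -/
noncomputable abbrev ratSpanModule : Module ℤ_[p] (RatSpan p U) :=
  Module.compHom (RatSpan p U) (algebraMap ℤ_[p] ℤ_[p][G])

theorem algebraMap_smul_eq (c : ℤ_[p]) (x : RatSpan p U) :
    algebraMap ℤ_[p] ℤ_[p][G] c • x = algebraMap ℚ_[p] ℚ_[p][G] (c : ℚ_[p]) • x := by
  rw [← algebraMap_smul ℚ_[p][G]]
  congr 1
  ext g
  simp

theorem eq_zero_of_algebraMap_smul_eq_zero {c : ℤ_[p]} (hc : c ≠ 0) {x : RatSpan p U}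
    (h : algebraMap ℤ_[p] ℤ_[p][G] c • x = 0) : x = 0 := by
  rw [algebraMap_smul_eq] at h
  have h1 := congrArg (algebraMap ℚ_[p] ℚ_[p][G] (c : ℚ_[p])⁻¹ • ·) h
  simp only [smul_zero] at h1
  rw [← mul_smul, ← map_mul, inv_mul_cancel₀ (fun h0 => hc (Subtype.ext h0)), map_one, one_smul] at h1
  exact h1

theorem mem_latPart {i : Idx p G} {x : RatSpan p U} :
    x ∈ latPart p U i ↔ ∃ w ∈ lat p G U, idem p i • w = x := Iff.rfl

theorem latPart_le_latStar (i : Idx p G) : latPart p U i ≤ latStar p G U :=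
  le_iSup (fun i => latPart p U i) i

theorem mem_diagramPart {i : Idx p G} {q : DiagramSpace p G U} :
    q ∈ diagramPart p U i ↔ ∃ y : latStar p G U, (y : RatSpan p U) ∈ latPart p U i ∧
      Submodule.Quotient.mk y = q := Iff.rfl

theorem diagram_mk_eq_iff {y z : latStar p G U} :
    (Submodule.Quotient.mk y : DiagramSpace p G U) = Submodule.Quotient.mk z ↔
      (y - z : RatSpan p U) ∈ lat p G U :=
  Submodule.Quotient.eq _

variable [Finite G]

theorem idem_smul_of_mem_latPart (hG : Nat.card G = p ^ 2) {i : Idx p G} {x : RatSpan p U}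
    (hx : x ∈ latPart p U i) : idem p i • x = x := by
  obtain ⟨w, -, rfl⟩ := mem_latPart.1 hx
  rw [← mul_smul, idem_mul_self hG]

theorem idem_smul_eq_zero (hG : Nat.card G = p ^ 2) {i j : Idx p G} (hij : i ≠ j)
    {x : RatSpan p U} (hx : x ∈ latPart p U j) : idem p i • x = 0 := by
  obtain ⟨w, -, rfl⟩ := mem_latPart.1 hx
  rw [← mul_smul, idem_mul_of_ne hG hij, zero_smul]

theorem idem_smul_mem_latPart (hG : Nat.card G = p ^ 2) (i : Idx p G) {x : RatSpan p U}
    (hx : x ∈ latStar p G U) : idem p i • x ∈ latPart p U i := by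
  suffices h : latStar p G U ≤ (latPart p U i).comap
      (DistribSMul.toLinearMap ℤ_[p][G] (RatSpan p U) (idem p i)) from h hx
  refine iSup_le fun j y hy => ?_
  change idem p i • y ∈ latPart p U i
  by_cases hij : i = j
  · subst hij
    rwa [idem_smul_of_mem_latPart hG hy]
  · rw [idem_smul_eq_zero hG hij hy]
    exact Submodule.zero_mem _

theorem lat_le_latStar (hG : Nat.card G = p ^ 2) (hexp : ∀ g : G, g ^ p = 1) :
    lat p G U ≤ latStar p G U := by
  have := Fintype.ofFinite {H : Subgroup G // Nat.card H = p}
  intro w hw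
  rw [← one_smul ℚ_[p][G] w, ← sum_idem hG hexp, Finset.sum_smul]
  exact Submodule.sum_mem _ fun i _ => latPart_le_latStar i (mem_latPart.2 ⟨w, hw, rfl⟩)

theorem sub_one_smul_idem_none (g : G) (x : RatSpan p U) :
    (MonoidAlgebra.of ℤ_[p] G g - 1) • idem p (none : Idx p G) • x = 0 := by
  rw [sub_smul, one_smul, of_smul_eq, ← mul_smul, of_mul_idem_none, sub_self]

theorem sub_one_smul_idem_some (H : {H : Subgroup G // Nat.card H = p}) {g : G} (hg : g ∈ H.1)
    (x : RatSpan p U) :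
    (MonoidAlgebra.of ℤ_[p] G g - 1) • idem p (some H) • x = 0 := by
  rw [sub_smul, one_smul, of_smul_eq, ← mul_smul, of_mul_idem_some H hg, sub_self]

omit [Finite G] in
theorem normKernelTrivial_iff (hU : IsLattice p U) {N : Subgroup G} {n : G} (hord : orderOf n = p)
    (hNn : N = Subgroup.zpowers n) :
    NormKernelTrivial p U n ↔ ∀ w ∈ lat p G U, hat p N • w = 0 →
      ∃ y ∈ lat p G U, w = (MonoidAlgebra.of ℤ_[p] G n - 1) • y := by
  have hinj := toRatSpan_injective (G := G) hU
  constructor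
  · rintro h _ ⟨u, rfl⟩ hu
    rw [← sum_pow_smul_eq_hat_smul hord hNn, ← map_smul, map_eq_zero_iff _ hinj] at hu
    obtain ⟨y, rfl⟩ := h u hu
    exact ⟨_, ⟨y, rfl⟩, map_smul _ _ _⟩
  · intro h x hx
    obtain ⟨_, ⟨y, rfl⟩, hy⟩ := h (toRatSpan p G U x) ⟨x, rfl⟩ (by
      rw [← sum_pow_smul_eq_hat_smul hord hNn, ← map_smul, hx, map_zero])
    exact ⟨y, hinj (by rw [hy, map_smul])⟩

theorem hat_smul_sub_one_smul {N : Subgroup G} {n : G} (hn : n ∈ N) (x : RatSpan p U) :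
    hat p N • (MonoidAlgebra.of ℤ_[p] G n - 1) • x = 0 := by
  rw [smul_comm, sub_smul, one_smul, of_smul_eq, ← mul_smul, of_mul_hat hn, sub_self]

theorem diagramPart_inf_le (hG : Nat.card G = p ^ 2) {N : Subgroup G} (hN : Nat.card N = p)
    {n : G} (hn : n ∈ N) (hgen : ∀ g ∈ N, ∃ k : ℕ, g = n ^ k)
    (h : ∀ w ∈ lat p G U, hat p N • w = 0 →
      ∃ y ∈ lat p G U, w = (MonoidAlgebra.of ℤ_[p] G n - 1) • y)
    (H : {H : Subgroup G // Nat.card H = p}) (hne : H.1 ≠ N) :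
    diagramPart p U (some H) ⊓
        (⨆ (K : {K : Subgroup G // Nat.card K = p}) (_ : K.1 ≠ N) (_ : K ≠ H),
          diagramPart p U (some K)) ≤
      augIdeal p N • diagramPart p U (some H) := by
  -- `Z` retains the only two properties needed of a sum over `K ≠ N, H`: it is killed by the norm
  -- of `N` and by `e_H`.
  let Z : Submodule ℤ_[p][G] (RatSpan p U) :=
    LinearMap.ker (DistribSMul.toLinearMap ℤ_[p][G] (RatSpan p U) (hat p N)) ⊓
      LinearMap.ker (DistribSMul.toLinearMap ℤ_[p][G] (RatSpan p U) (idem p (some H)))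
  have hZ : (⨆ (K : {K : Subgroup G // Nat.card K = p}) (_ : K.1 ≠ N) (_ : K ≠ H),
      diagramPart p U (some K)) ≤
        (Z.submoduleOf (latStar p G U)).map ((lat p G U).submoduleOf (latStar p G U)).mkQ := by
    refine iSup_le fun K => iSup_le fun hKN => iSup_le fun hKH => Submodule.map_mono fun y hy => ?_
    exact ⟨hat_smul_eq_zero hG hN K hKN (idem_smul_of_mem_latPart hG hy),
      idem_smul_eq_zero hG (fun h => hKH (Option.some_injective _ h).symm) hy⟩
  rintro q ⟨hqH, hq⟩
  obtain ⟨x, hx, rfl⟩ := mem_diagramPart.1 hqH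
  obtain ⟨y, ⟨hy1, hy2⟩, hyx⟩ := hZ hq
  have hyN : hat p N • (y : RatSpan p U) = 0 := hy1
  have hyH : idem p (some H) • (y : RatSpan p U) = 0 := hy2
  have hxH := idem_smul_of_mem_latPart hG hx
  have hmem := diagram_mk_eq_iff.1 hyx.symm
  obtain ⟨u, hu, hxy⟩ := h _ hmem (by
    rw [smul_sub, hyN, hat_smul_eq_zero hG hN H hne hxH, sub_zero])
  have huH : idem p (some H) • u ∈ latPart p U (some H) := ⟨u, hu, rfl⟩
  -- Apply `e_H` to `x - y = (n - 1) u`.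
  have hxu : (x : RatSpan p U) =
      (MonoidAlgebra.of ℤ_[p] G n - 1) • idem p (some H) • u := by
    rw [smul_comm, ← hxy, smul_sub, hyH, hxH, sub_zero]
  rw [mem_augIdeal_smul hn hgen]
  refine ⟨Submodule.Quotient.mk ⟨_, latPart_le_latStar _ huH⟩,
    mem_diagramPart.2 ⟨_, huH, rfl⟩, ?_⟩
  rw [← Submodule.Quotient.mk_smul]
  exact congrArg _ (Subtype.ext hxu)

theorem invariants_le (hG : Nat.card G = p ^ 2) {N : Subgroup G} (hN : Nat.card N = p)
    {n : G} (hord : orderOf n = p) (hNn : N = Subgroup.zpowers n) (hn : n ∈ N)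
    (h : ∀ w ∈ lat p G U, hat p N • w = 0 →
      ∃ y ∈ lat p G U, w = (MonoidAlgebra.of ℤ_[p] G n - 1) • y)
    (hstar : lat p G U ≤ latStar p G U) :
    invariants p N (DiagramSpace p G U) ≤
      diagramPart p U none ⊔ diagramPart p U (some ⟨N, hN⟩) := by
  intro q hq
  obtain ⟨x, rfl⟩ := Submodule.Quotient.mk_surjective _ q
  have h1 := hq n hn
  rw [← Submodule.Quotient.mk_smul, diagram_mk_eq_iff] at h1
  have h2 : (MonoidAlgebra.of ℤ_[p] G n - 1) • (x : RatSpan p U) ∈ lat p G U := by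
    rw [sub_smul, one_smul]
    exact h1
  obtain ⟨u, hu, hxu⟩ := h _ h2 (hat_smul_sub_one_smul hn _)
  -- `y` represents the same class as `x` but is itself fixed by `n`, so it is the sum of its
  -- components at `0` and `N`.
  let y : latStar p G U := x - ⟨u, hstar hu⟩
  have hy0 : (MonoidAlgebra.of ℤ_[p] G n - 1) • (y : RatSpan p U) = 0 := by
    change (MonoidAlgebra.of ℤ_[p] G n - 1) • ((x : RatSpan p U) - u) = 0
    rw [smul_sub, hxu, sub_self]
  have hyn : MonoidAlgebra.of ℤ_[p] G n • (y : RatSpan p U) = y := by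
    rwa [sub_smul, one_smul, sub_eq_zero] at hy0
  have hyk : ∀ k : ℕ, MonoidAlgebra.of ℤ_[p] G n ^ k • (y : RatSpan p U) = y := fun k => by
    induction k with
    | zero => rw [pow_zero, one_smul]
    | succ k ih => rw [pow_succ, mul_smul, hyn, ih]
  have hhat : hat p N • (y : RatSpan p U) = (p : ℚ_[p][G]) • (y : RatSpan p U) := by
    rw [← sum_pow_smul_eq_hat_smul hord hNn, Finset.sum_smul, Finset.sum_congr rfl fun k _ => hyk k,
      Finset.sum_const, Finset.card_range, Nat.cast_smul_eq_nsmul]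
  have hsum : (y : RatSpan p U) =
      idem p (none : Idx p G) • (y : RatSpan p U) + idem p (some ⟨N, hN⟩) • (y : RatSpan p U) := by
    rw [← add_smul, idem_none_add_idem_some, mul_smul, hhat, ← mul_smul, invOf_mul_natCast,
      one_smul]
  have ha := idem_smul_mem_latPart hG none y.2
  have hb := idem_smul_mem_latPart hG (some ⟨N, hN⟩) y.2
  have hq' : (Submodule.Quotient.mk x : DiagramSpace p G U) =
      Submodule.Quotient.mk ⟨_, latPart_le_latStar _ ha⟩ +
        Submodule.Quotient.mk ⟨_, latPart_le_latStar _ hb⟩ := by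
    rw [← Submodule.Quotient.mk_add, diagram_mk_eq_iff]
    change (x : RatSpan p U) - (_ + _) ∈ _
    rw [← hsum]
    change (x : RatSpan p U) - (x - u) ∈ _
    rwa [sub_sub_cancel]
  rw [hq']
  exact Submodule.add_mem_sup (mem_diagramPart.2 ⟨_, ha, rfl⟩) (mem_diagramPart.2 ⟨_, hb, rfl⟩)

/-- In a reduced lattice, `U ∩ e_H U` is contained in the radical `(n - 1) e_H U` of `e_H U`. -/
theorem exists_eq_sub_one_smul_of_isReduced (hG : Nat.card G = p ^ 2) (hU : IsLattice p U)
    (hred : IsReduced p G U) {N : Subgroup G} (hN : Nat.card N = p)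
    {n : G} (hord : orderOf n = p) (hNn : N = Subgroup.zpowers n)
    (hgen : ∀ g ∈ N, ∃ k : ℕ, g = n ^ k) (H : {H : Subgroup G // Nat.card H = p}) (hne : H.1 ≠ N)
    {x : RatSpan p U} (hx : x ∈ lat p G U) (hxH : x ∈ latPart p U (some H)) :
    ∃ y ∈ latPart p U (some H), x = (MonoidAlgebra.of ℤ_[p] G n - 1) • y := by
  by_contra! hnot
  have := hU.finite
  let := ratSpanModule p G U
  have : IsScalarTower ℤ_[p] ℤ_[p][G] (RatSpan p U) :=
    IsScalarTower.of_algebraMap_smul fun _ _ => rfl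
  have : Module.IsTorsionFree ℤ_[p] (RatSpan p U) :=
    Module.IsTorsionFree.of_smul_eq_zero fun c x hcx => or_iff_not_imp_left.2 fun hc =>
      eq_zero_of_algebraMap_smul_eq_zero (G := G) hc hcx
  obtain ⟨u, rfl⟩ := hx
  obtain ⟨W, W', hW, ⟨e⟩⟩ := exists_isCompl_equiv_Lam hG hN hord hNn hgen H hne
    (toRatSpan p G U) (toRatSpan_injective hU) (idem_smul_of_mem_latPart hG hxH)
    fun v => hnot _ (mem_latPart.2 ⟨_, ⟨v, rfl⟩, rfl⟩)
  exact (hred.no_Lam (some H) W W' hW).false e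

/-- Divide `w` by `n - 1` component by component, obtaining a quotient in `U_*`, then use the
invariants to move that quotient into `U`. -/
theorem exists_eq_sub_one_smul_of_diagram (hG : Nat.card G = p ^ 2) (hexp : ∀ g : G, g ^ p = 1)
    {N : Subgroup G} (hN : Nat.card N = p)
    {n : G} (hn : n ∈ N) (hgen : ∀ g ∈ N, ∃ k : ℕ, g = n ^ k)
    (hred : ∀ H : {H : Subgroup G // Nat.card H = p}, H.1 ≠ N → ∀ x ∈ lat p G U,
      x ∈ latPart p U (some H) →
        ∃ y ∈ latPart p U (some H), x = (MonoidAlgebra.of ℤ_[p] G n - 1) • y)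
    (h1 : ∀ H : {H : Subgroup G // Nat.card H = p}, H.1 ≠ N →
      diagramPart p U (some H) ⊓
          (⨆ (K : {K : Subgroup G // Nat.card K = p}) (_ : K.1 ≠ N) (_ : K ≠ H),
            diagramPart p U (some K)) ≤
        augIdeal p N • diagramPart p U (some H))
    (h2 : invariants p N (DiagramSpace p G U) ≤
      diagramPart p U none ⊔ diagramPart p U (some ⟨N, hN⟩))
    {w : RatSpan p U} (hw : w ∈ lat p G U) (hNw : hat p N • w = 0) :
    ∃ y ∈ lat p G U, w = (MonoidAlgebra.of ℤ_[p] G n - 1) • y := by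
  classical
  have := Fintype.ofFinite {H : Subgroup G // Nat.card H = p}
  have hpart : ∀ i : Idx p G, idem p i • w ∈ latPart p U i := fun i => ⟨w, hw, rfl⟩
  have hsum : w = ∑ i : Idx p G, idem p i • w := by
    rw [← Finset.sum_smul, sum_idem hG hexp, one_smul]
  have hw0 : idem p (none : Idx p G) • w = 0 := by
    have h3 : idem p (none : Idx p G) = idem p (none : Idx p G) *
        (algebraMap ℚ_[p] ℚ_[p][G] (p : ℚ_[p])⁻¹ * hat p N) := by
      rw [← idem_none_add_idem_some ⟨N, hN⟩, mul_add, idem_mul_self hG,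
        idem_mul_of_ne hG (by simp), add_zero]
    rw [h3, mul_smul, mul_smul, hNw, smul_zero, smul_zero]
  have hwN : idem p (some ⟨N, hN⟩) • w = 0 := by
    have h3 := congrArg (· • w) (idem_none_add_idem_some (p := p) ⟨N, hN⟩)
    simp only [add_smul, hw0, zero_add, mul_smul, hNw, smul_zero] at h3
    exact h3
  have key : ∀ i : Idx p G, ∃ y ∈ latPart p U i,
      idem p i • w = (MonoidAlgebra.of ℤ_[p] G n - 1) • y := by
    rintro (_ | H)
    · exact ⟨0, Submodule.zero_mem _, by rw [hw0, smul_zero]⟩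
    by_cases hHN : H.1 = N
    · obtain rfl : H = ⟨N, hN⟩ := Subtype.ext hHN
      exact ⟨0, Submodule.zero_mem _, by rw [hwN, smul_zero]⟩
    let m : ∀ i : Idx p G, DiagramSpace p G U := fun i =>
      Submodule.Quotient.mk ⟨_, latPart_le_latStar i (hpart i)⟩
    have hm : ∑ i, m i = 0 := by
      have : ∑ i, m i = Submodule.Quotient.mk (∑ i : Idx p G,
          (⟨_, latPart_le_latStar i (hpart i)⟩ : latStar p G U)) :=
        (map_sum (Submodule.mkQ _) _ _).symm
      rw [this, Submodule.Quotient.mk_eq_zero]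
      change ((∑ i : Idx p G, (⟨_, latPart_le_latStar i (hpart i)⟩ : latStar p G U) :
        latStar p G U) : RatSpan p U) ∈ lat p G U
      rw [Submodule.coe_sum, ← hsum]
      exact hw
    have hmpart : ∀ i, m i ∈ diagramPart p U i := fun i =>
      mem_diagramPart.2 ⟨_, hpart i, rfl⟩
    -- The classes `m i` sum to zero because `w` lies in `U`, and those at `0` and `N` vanish; so `m
    -- (some H)` is minus the sum over `K ≠ N, H`.
    have hmH : m (some H) ∈ augIdeal p N • diagramPart p U (some H) := by
      refine h1 H hHN ⟨hmpart _, ?_⟩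
      rw [← Finset.add_sum_erase _ _ (Finset.mem_univ (some H))] at hm
      rw [eq_neg_of_add_eq_zero_left hm]
      refine Submodule.neg_mem _ (Submodule.sum_mem _ fun i hi => ?_)
      rcases i with _ | K
      · have : m none = 0 := by
          rw [Submodule.Quotient.mk_eq_zero]
          change idem p (none : Idx p G) • w ∈ lat p G U
          rw [hw0]
          exact Submodule.zero_mem _
        rw [this]
        exact Submodule.zero_mem _
      by_cases hKN : K.1 = N
      · have : m (some K) = 0 := by
          obtain rfl : K = ⟨N, hN⟩ := Subtype.ext hKN
          rw [Submodule.Quotient.mk_eq_zero]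
          change idem p (some ⟨N, hN⟩) • w ∈ lat p G U
          rw [hwN]
          exact Submodule.zero_mem _
        rw [this]
        exact Submodule.zero_mem _
      · have hKH : K ≠ H := fun h => (Finset.mem_erase.1 hi).1 (congrArg some h)
        exact Submodule.mem_iSup_of_mem K (Submodule.mem_iSup_of_mem hKN
          (Submodule.mem_iSup_of_mem hKH (hmpart _)))
    obtain ⟨q, hq, hmq⟩ := (mem_augIdeal_smul hn hgen _ _).1 hmH
    obtain ⟨y, hy, rfl⟩ := mem_diagramPart.1 hq
    rw [← Submodule.Quotient.mk_smul, diagram_mk_eq_iff] at hmq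
    -- The error in dividing `e_H w` by `n - 1` lies in `U ∩ U_(H)`, where `hred` allows one more
    -- division.
    obtain ⟨z, hz, hyz⟩ := hred H hHN _ hmq
      (Submodule.sub_mem _ (hpart _) (Submodule.smul_mem _ _ hy))
    refine ⟨y + z, Submodule.add_mem _ hy hz, ?_⟩
    rw [smul_add, ← hyz]
    exact (add_sub_cancel _ _).symm
  choose y hy hwy using key
  let x : latStar p G U := ⟨∑ i, y i, Submodule.sum_mem _ fun i _ => latPart_le_latStar i (hy i)⟩
  have hwx : w = (MonoidAlgebra.of ℤ_[p] G n - 1) • (x : RatSpan p U) := by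
    conv_lhs => rw [hsum]
    simp only [x, Finset.smul_sum, hwy]
  -- `(n - 1) x = w` lies in `U`, so the class of `x` is fixed by `N`.
  have hinv : (Submodule.Quotient.mk x : DiagramSpace p G U) ∈
      invariants p N (DiagramSpace p G U) := by
    intro g hg
    obtain ⟨k, rfl⟩ := hgen g hg
    obtain ⟨r, hr⟩ := of_sub_one_dvd (R := ℤ_[p]) n k
    rw [← Submodule.Quotient.mk_smul, diagram_mk_eq_iff]
    have h3 : (MonoidAlgebra.of ℤ_[p] G (n ^ k) - 1) • (x : RatSpan p U) = r • w := by
      rw [hr, mul_comm, mul_smul, ← hwx]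
    rw [sub_smul, one_smul] at h3
    exact (congrArg (· ∈ lat p G U) h3).mpr (Submodule.smul_mem _ _ hw)
  obtain ⟨a, ha, b, hb, hab⟩ := Submodule.mem_sup.1 (h2 hinv)
  obtain ⟨a, ha', rfl⟩ := mem_diagramPart.1 ha
  obtain ⟨b, hb', rfl⟩ := mem_diagramPart.1 hb
  rw [← Submodule.Quotient.mk_add, eq_comm, diagram_mk_eq_iff] at hab
  -- The witness is `x - (a + b)`; `n` fixes `a` and `b`, so multiplying by `n - 1` still gives `w`.
  refine ⟨_, hab, ?_⟩
  have ha0 : (MonoidAlgebra.of ℤ_[p] G n - 1) • (a : RatSpan p U) = 0 := by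
    rw [← idem_smul_of_mem_latPart hG ha', sub_one_smul_idem_none]
  have hb0 : (MonoidAlgebra.of ℤ_[p] G n - 1) • (b : RatSpan p U) = 0 := by
    rw [← idem_smul_of_mem_latPart hG hb', sub_one_smul_idem_some ⟨N, hN⟩ hn]
  rw [smul_sub, Submodule.coe_add, smul_add, ha0, hb0, add_zero, sub_zero, hwx]

end Diagram

end ButlerLattice

open ButlerLattice in
open scoped MonoidAlgebra in
theorem mainTheorem4 (p : ℕ) [Fact p.Prime] {G : Type*} [CommGroup G]
    (hG : Nonempty (G ≃* Multiplicative (ZMod p) × Multiplicative (ZMod p)))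
    (N : Subgroup G) (hN : Nat.card N = p)
    {U : Type*} [AddCommGroup U] [Module ℤ_[p] U] [Module ℤ_[p][G] U]
    [IsScalarTower ℤ_[p] ℤ_[p][G] U]
    (hU : IsLattice p U) (hred : IsReduced p G U) :
    (IsLattice p (Coinvariants p N U) ↔ IsPermutationRestrictedTo p U N) ∧
    (IsLattice p (Coinvariants p N U) ↔
      (∀ H : {H : Subgroup G // Nat.card H = p}, H.1 ≠ N →
        diagramPart p U (some H) ⊓
            (⨆ (K : {K : Subgroup G // Nat.card K = p}) (_ : K.1 ≠ N) (_ : K ≠ H),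
              diagramPart p U (some K)) ≤
          augIdeal p N • diagramPart p U (some H)) ∧
      invariants p N (DiagramSpace p G U) ≤
        diagramPart p U none ⊔ diagramPart p U (some ⟨N, hN⟩)) := by

  obtain ⟨φ⟩ := hG
  have : Finite G := Finite.of_equiv _ φ.symm.toEquiv
  have hcard : Nat.card G = p ^ 2 := by
    rw [Nat.card_congr φ.toEquiv, Nat.card_prod, Nat.card_congr Multiplicative.toAdd,
      Nat.card_zmod, sq]
  have hexp : ∀ g : G, g ^ p = 1 := fun g => by
    apply φ.injective
    rw [map_pow, map_one]
    ext <;> simp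
  obtain ⟨n, hord, hNn, hgen⟩ := exists_generator hN
  have hn : n ∈ N := hNn ▸ Subgroup.mem_zpowers n
  have hnp : n ^ p = 1 := hexp n
  have hstar := lat_le_latStar (p := p) (U := U) hcard hexp
  have hcoinv := isLattice_coinvariants_iff hU hn hnp hgen
  refine ⟨hcoinv.trans (isPermutationRestrictedTo_iff hU hn hnp hgen).symm, ?_⟩
  rw [hcoinv, normKernelTrivial_iff hU hord hNn]
  constructor
  · intro h
    exact ⟨fun H hne => diagramPart_inf_le hcard hN hn hgen h H hne,
      invariants_le hcard hN hord hNn hn h hstar⟩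
  · rintro ⟨h1, h2⟩ w hw hNw
    exact exists_eq_sub_one_smul_of_diagram hcard hexp hN hn hgen
      (fun H hne x hx hxH =>
        exists_eq_sub_one_smul_of_isReduced hcard hU hred hN hord hNn hgen H hne hx hxH)
      h1 h2 hw hNw
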